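/- Let $q\in L^1_{loc}(\mathbb R)$ be real valued and even, such that $\tau_q(y)=-y''-qy$ is in the limit circle case at $+\infty$ and at $-\infty$ (for every $\lambda\in\mathbb C$ all solutions of $\tau_q y=\lambda y$ are square integrable near $\pm\infty$). Let $\mathcal D_{\max}=\{y\in L^2(\mathbb R): y,y'\in AC_{loc}(\mathbb R),\ \tau_q y\in L^2(\mathbb R)\}$, let $A_{\max}y=\tau_q y$ on $\mathcal D_{\max}$, and let $A$ be the closure of the restriction of $A_{\max}$ to the functions in $\mathcal D_{\max}$ with compact support, so that $A^*=A_{\max}$. Let $(\mathcal Pf)(x)=f(-x)$ and, for an operator $T$ in $L^2(\mathbb R)$, $T^+=\mathcal P T^*\mathcal P$. Put $[f,g]_x=\overline{f(x)}g'(x)-\overline{f'(x)}g(x)$ and $[f,g]_{\pm\infty}=\lim_{x\to\pm\infty}[f,g]_x$. Let $w_1,w_2$ be real valued solutions of $\tau_q y=0$, $w_1$ odd and $w_2$ even, with $[w_1,w_2]_{-\infty}=[w_1,w_2]_{\infty}=1$, and for $f\in\mathcal D_{\max}$ and $j=1,2$ put $\alpha_j(f)=[w_j,f]_{-\infty}$,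 $\beta_j(f)=[w_j,f]_{\infty}$. A two-dimensional bi-extension of $A$ is a closed operator $\widetilde A$ with $A\subset\widetilde A\subset A^*$ and $\dim(\operatorname{dom}\widetilde A/\operatorname{dom}A)=2$. The domain of every two-dimensional bi-extension of $A$ has one of the forms in (1), (2), (3) below, where in (1) one may take $\alpha,\beta\in[0,2\pi)$. For every restriction $\widetilde A$ of $A_{\max}$ one has $\operatorname{dom}\widetilde A^+=\mathcal P\operatorname{dom}\widetilde A^*$. Moreover, for every restriction $\widetilde A$ of $A_{\max}$: (1) If, with $\xi,\eta\in\mathbb C$, $|\xi|=|\eta|=1$ and $\alpha,\beta\in\mathbb R$, $$\operatorname{dom}\widetilde A=\{f\in\mathcal D_{\max}:\ \alpha_1(f)\,\xi\cos\alpha-\alpha_2(f)\sin\alpha=0,\ \beta_1(f)\,\eta\cos\beta-\beta_2(f)\sin\beta=0\},$$ then $$\operatorname{dom}\widetilde A^*=\{g\in\mathcal D_{\max}:\ \alpha_1(g)\cos\alpha-\alpha_2(g)\,\xi\sin\alpha=0,\ \beta_1(g)\cos\beta-\beta_2(g)\,\eta\sin\beta=0\},$$ $$\operatorname{dom}\widetilde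 A^+=\{g\in\mathcal D_{\max}:\ \alpha_1(g)\cos\beta+\alpha_2(g)\,\eta\sin\beta=0,\ \beta_1(g)\cos\alpha+\beta_2(g)\,\xi\sin\alpha=0\}.$$ (2) If, with $a,b,c,d\in\mathbb C$, $$\operatorname{dom}\widetilde A=\Big\{f\in\mathcal D_{\max}:\ \begin{pmatrix}\beta_1(f)\\ \beta_2(f)\end{pmatrix}=\begin{bmatrix}a&b\\c&d\end{bmatrix}\begin{pmatrix}\alpha_1(f)\\ \alpha_2(f)\end{pmatrix}\Big\},$$ then $$\operatorname{dom}\widetilde A^*=\Big\{g\in\mathcal D_{\max}:\ \begin{pmatrix}\alpha_1(g)\\ \alpha_2(g)\end{pmatrix}=\begin{bmatrix}\overline d&-\overline b\\-\overline c&\overline a\end{bmatrix}\begin{pmatrix}\beta_1(g)\\ \beta_2(g)\end{pmatrix}\Big\},$$ $$\operatorname{dom}\widetilde A^+=\Big\{g\in\mathcal D_{\max}:\ \begin{pmatrix}\beta_1(g)\\ \beta_2(g)\end{pmatrix}=\begin{bmatrix}\overline d&\overline b\\ \overline c&\overline a\end{bmatrix}\begin{pmatrix}\alpha_1(g)\\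 \alpha_2(g)\end{pmatrix}\Big\}.$$ (3) If, with $a,b,c,d\in\mathbb C$, $$\operatorname{dom}\widetilde A=\Big\{f\in\mathcal D_{\max}:\ \begin{pmatrix}\alpha_1(f)\\ \alpha_2(f)\end{pmatrix}=\begin{bmatrix}a&b\\c&d\end{bmatrix}\begin{pmatrix}\beta_1(f)\\ \beta_2(f)\end{pmatrix}\Big\},$$ then $$\operatorname{dom}\widetilde A^*=\Big\{g\in\mathcal D_{\max}:\ \begin{pmatrix}\beta_1(g)\\ \beta_2(g)\end{pmatrix}=\begin{bmatrix}\overline d&-\overline b\\-\overline c&\overline a\end{bmatrix}\begin{pmatrix}\alpha_1(g)\\ \alpha_2(g)\end{pmatrix}\Big\},$$ $$\operatorname{dom}\widetilde A^+=\Big\{g\in\mathcal D_{\max}:\ \begin{pmatrix}\alpha_1(g)\\ \alpha_2(g)\end{pmatrix}=\begin{bmatrix}\overline d&\overline b\\ \overline c&\overline a\end{bmatrix}\begin{pmatrix}\beta_1(g)\\ \beta_2(g)\end{pmatrix}\Big\}.$$ -/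

import Mathlib

open MeasureTheory Filter Topology
open scoped ComplexConjugate ComplexInnerProductSpace

noncomputable section

namespace LimitCircle

/-- The Hilbert space `L²(ℝ)` of complex valued functions. -/
abbrev L2 : Type := Lp ℂ 2 (volume : Measure ℝ)

/-- `AC_loc(ℝ)`: absolute continuity on every compact interval. -/
def LocAC (y : ℝ → ℂ) : Prop := ∀ a b : ℝ, AbsolutelyContinuousOnInterval y a b

/-- `y, y' ∈ AC_loc(ℝ)`. -/
structure Regular (y : ℝ → ℂ) : Prop where
  diff : Differentiable ℝ y
  ac : LocAC y
  ac_deriv : LocAC (deriv y)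

/-- The differential expression `τ_q y = -y'' - q y` (meaningful almost everywhere for regular
`y`). -/
def tau (q : ℝ → ℝ) (y : ℝ → ℂ) (x : ℝ) : ℂ := -deriv (deriv y) x - (q x : ℂ) * y x

/-- `y` is a solution of `τ_q y = lam y` on the real line. -/
structure IsSolution (q : ℝ → ℝ) (lam : ℂ) (y : ℝ → ℂ) : Prop where
  regular : Regular y
  eqn : ∀ᵐ x : ℝ, tau q y x = lam * y x

/-- Limit circle case at `+∞`: all solutions are square integrable near `+∞`. -/
def IsLimitCircleTop (q : ℝ → ℝ) : Prop :=
  ∀ (lam : ℂ) (y : ℝ → ℂ), IsSolution q lam y →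
    ∃ a : ℝ, MemLp y 2 (volume.restrict (Set.Ioi a))

/-- Limit circle case at `-∞`: all solutions are square integrable near `-∞`. -/
def IsLimitCircleBot (q : ℝ → ℝ) : Prop :=
  ∀ (lam : ℂ) (y : ℝ → ℂ), IsSolution q lam y →
    ∃ a : ℝ, MemLp y 2 (volume.restrict (Set.Iio a))

/-! ### The maximal and minimal operators -/

theorem LocAC.ae_differentiableAt {y : ℝ → ℂ} (h : LocAC y) :
    ∀ᵐ x : ℝ, DifferentiableAt ℝ y x := by
  have hv : LocallyBoundedVariationOn y Set.univ := by
    intro a b _ _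
    refine BoundedVariationOn.mono ((h a b).boundedVariationOn) ?_
    rw [Set.univ_inter]
    exact Set.Icc_subset_uIcc
  exact hv.ae_differentiableAt

theorem Regular.zero : Regular 0 := by
  have h0 : LocAC 0 := by
    intro a b
    have : LipschitzOnWith 0 (0 : ℝ → ℂ) (Set.uIcc a b) :=
      (LipschitzWith.const (0 : ℂ)).lipschitzOnWith
    exact this.absolutelyContinuousOnInterval
  refine ⟨differentiable_const (0 : ℂ), h0, ?_⟩
  have : deriv (0 : ℝ → ℂ) = 0 := by ext x; simp
  rw [this]
  exact h0

theorem Regular.add {y z : ℝ → ℂ} (hy : Regular y) (hz : Regular z) : Regular (y + z) := by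
  refine ⟨hy.diff.add hz.diff, fun a b => (hy.ac a b).add (hz.ac a b), ?_⟩
  have : deriv (y + z) = deriv y + deriv z := by
    ext x; exact deriv_add (hy.diff x) (hz.diff x)
  rw [this]
  exact fun a b => (hy.ac_deriv a b).add (hz.ac_deriv a b)

theorem Regular.smul {y : ℝ → ℂ} (c : ℂ) (hy : Regular y) : Regular (c • y) := by
  refine ⟨hy.diff.const_smul c, fun a b => (hy.ac a b).const_smul c, ?_⟩
  have : deriv (c • y) = c • deriv y := by
    ext x; exact deriv_const_smul c (hy.diff x)
  rw [this]
  exact fun a b => (hy.ac_deriv a b).const_smul c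

theorem tau_add (q : ℝ → ℝ) {y z : ℝ → ℂ} (hy : Regular y) (hz : Regular z) :
    tau q (y + z) =ᵐ[volume] tau q y + tau q z := by
  have h1 : deriv (y + z) = deriv y + deriv z := by
    ext x; exact deriv_add (hy.diff x) (hz.diff x)
  filter_upwards [hy.ac_deriv.ae_differentiableAt, hz.ac_deriv.ae_differentiableAt] with x hx hx'
  simp only [tau, h1, Pi.add_apply, deriv_add hx hx']
  ring

theorem tau_smul (q : ℝ → ℝ) (c : ℂ) {y : ℝ → ℂ} (hy : Regular y) :
    tau q (c • y) =ᵐ[volume] c • tau q y := by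
  have h1 : deriv (c • y) = c • deriv y := by
    ext x; exact deriv_const_smul c (hy.diff x)
  filter_upwards [hy.ac_deriv.ae_differentiableAt] with x hx
  simp only [tau, h1, Pi.smul_apply, deriv_const_smul c hx, smul_eq_mul]
  ring

theorem tau_zero (q : ℝ → ℝ) : tau q 0 = 0 := by
  have h : deriv (0 : ℝ → ℂ) = 0 := by ext x; simp
  ext x
  simp [tau, h]

/-- The maximal domain `{y ∈ L²(ℝ) : y, y' ∈ AC_loc(ℝ), τ_q y ∈ L²(ℝ)}`, as a space of
(continuously differentiable) functions. -/
def maxFun (q : ℝ → ℝ) : Submodule ℂ (ℝ → ℂ) where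
  carrier := {y | Regular y ∧ MemLp y 2 volume ∧ MemLp (tau q y) 2 volume}
  zero_mem' := ⟨Regular.zero, MemLp.zero, by rw [tau_zero]; exact MemLp.zero⟩
  add_mem' := fun {_ _} hy hz => ⟨hy.1.add hz.1, hy.2.1.add hz.2.1,
    (hy.2.2.add hz.2.2).ae_eq (tau_add q hy.1 hz.1).symm⟩
  smul_mem' := fun c _ hy => ⟨hy.1.smul c, hy.2.1.const_smul c,
    (hy.2.2.const_smul c).ae_eq (tau_smul q c hy.1).symm⟩

/-- The class in `L²(ℝ)` of a function of the maximal domain. -/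
def toL2 (q : ℝ → ℝ) : maxFun q →ₗ[ℂ] L2 where
  toFun y := y.2.2.1.toLp y.1
  map_add' _ _ := rfl
  map_smul' _ _ := rfl

/-- The class of `τ_q y` in `L²(ℝ)`. -/
def tauL2 (q : ℝ → ℝ) : maxFun q →ₗ[ℂ] L2 where
  toFun y := y.2.2.2.toLp (tau q y.1)
  map_add' y z := by
    rw [← MemLp.toLp_add, MemLp.toLp_eq_toLp_iff]
    exact tau_add q y.2.1 z.2.1
  map_smul' c y := by
    rw [RingHom.id_apply, ← MemLp.toLp_const_smul, MemLp.toLp_eq_toLp_iff]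
    exact tau_smul q c y.2.1

theorem toL2_injective (q : ℝ → ℝ) : Function.Injective (toL2 q) := by
  intro y z h
  have h' : (y : ℝ → ℂ) =ᵐ[volume] z :=
    (MemLp.toLp_eq_toLp_iff y.2.2.1 z.2.2.1).1 h
  exact Subtype.ext
    (Continuous.ae_eq_iff_eq volume y.2.1.diff.continuous z.2.1.diff.continuous |>.1 h')

/-- The maximal operator `A_max y = τ_q y` in `L²(ℝ)`. -/
def maxOp (q : ℝ → ℝ) : L2 →ₗ.[ℂ] L2 where
  domain := LinearMap.range (toL2 q)
  toFun := (tauL2 q).comp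
    (LinearEquiv.ofInjective (toL2 q) (toL2_injective q)).symm.toLinearMap

/-- The domain of the pre-minimal operator: functions of the maximal domain with compact
support. -/
def preMinDomain (q : ℝ → ℝ) : Submodule ℂ L2 where
  carrier := {f | ∃ y : maxFun q, HasCompactSupport (y : ℝ → ℂ) ∧ toL2 q y = f}
  zero_mem' := ⟨0, HasCompactSupport.zero, map_zero _⟩
  add_mem' := by
    rintro _ _ ⟨y, hy, rfl⟩ ⟨z, hz, rfl⟩
    exact ⟨y + z, HasCompactSupport.add hy hz, map_add _ _ _⟩
  smul_mem' := by
    rintro c _ ⟨y, hy, rfl⟩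
    exact ⟨c • y, HasCompactSupport.smul_left (f := fun _ : ℝ => c) hy, map_smul _ _ _⟩

/-- The minimal operator `A`: the closure of the restriction of the maximal operator to the
functions with compact support. -/
def minOp (q : ℝ → ℝ) : L2 →ₗ.[ℂ] L2 := ((maxOp q).domRestrict (preMinDomain q)).closure

/-! ### Bi-extensions and the Krein space adjoint -/

/-- A closed operator `T` with `A ⊆ T ⊆ A*` is a bi-extension of `A`. -/
structure IsBiExtension (A T : L2 →ₗ.[ℂ] L2) : Prop where
  closed : T.IsClosed
  le : A ≤ T
  le_adjoint : T ≤ A.adjoint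

/-- `T` is a two-dimensional bi-extension of `A`, i.e. `dim (dom T / dom A) = 2`. -/
structure IsTwoDimBiExtension (A T : L2 →ₗ.[ℂ] L2) : Prop extends IsBiExtension A T where
  finrank_eq : Module.finrank ℂ (T.domain ⧸ A.domain.submoduleOf T.domain) = 2

/-- Parity `(P f)(x) = f(-x)` on `L²(ℝ)`. -/
def parity : L2 →ₗ[ℂ] L2 :=
  (Lp.compMeasurePreservingₗᵢ ℂ (Neg.neg : ℝ → ℝ)
    (Measure.measurePreserving_neg (volume : Measure ℝ))).toLinearMap

/-- The adjoint `T⁺ = P T* P` with respect to the Krein space inner product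
`[f, g] = ∫ f(x) conj (g(-x)) dx`, whose fundamental symmetry is the parity `P`. -/
def kreinAdjoint (T : L2 →ₗ.[ℂ] L2) : L2 →ₗ.[ℂ] L2 where
  domain := T.adjoint.domain.comap parity
  toFun := parity ∘ₗ T.adjoint.toFun ∘ₗ
    parity.restrict (p := T.adjoint.domain.comap parity) (q := T.adjoint.domain) (fun _ hx => hx)

/-! ### Boundary values -/

/-- `[f, g]_x = conj (f x) g'(x) - conj (f'(x)) g(x)`. -/
def bracket (f g : ℝ → ℂ) (x : ℝ) : ℂ := conj (f x) * deriv g x - conj (deriv f x) * g x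

/-- `[w, y]_{-∞}`. -/
def bvBot (w y : ℝ → ℂ) : ℂ := limUnder atBot (bracket w y)

/-- `[w, y]_{+∞}`. -/
def bvTop (w y : ℝ → ℂ) : ℂ := limUnder atTop (bracket w y)

/-- `w₁` and `w₂` are real valued solutions of `τ_q y = 0`, `w₁` odd and `w₂` even, with
`[w₁, w₂]_{-∞} = [w₁, w₂]_{+∞} = 1`. (In the limit circle case they lie in the maximal domain,
and `[wⱼ, wⱼ]` vanishes because `wⱼ` is real.) -/
structure IsReferencePair (q : ℝ → ℝ) (w₁ w₂ : ℝ → ℂ) : Prop where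
  sol₁ : IsSolution q 0 w₁
  sol₂ : IsSolution q 0 w₂
  real₁ : ∀ x, (w₁ x).im = 0
  real₂ : ∀ x, (w₂ x).im = 0
  odd₁ : ∀ x, w₁ (-x) = -w₁ x
  even₂ : ∀ x, w₂ (-x) = w₂ x
  bracket_bot : Tendsto (bracket w₁ w₂) atBot (𝓝 1)
  bracket_top : Tendsto (bracket w₁ w₂) atTop (𝓝 1)

/-- The elements of the maximal domain, as a subset of `L²(ℝ)`, which satisfy the boundary
condition `C`. The condition is given in terms of `(α₁, α₂)` and `(β₁, β₂)` where
`αⱼ = [wⱼ, y]_{-∞}` and `βⱼ = [wⱼ, y]_{+∞}`. -/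
def bcDomain (q : ℝ → ℝ) (w₁ w₂ : ℝ → ℂ) (C : (Fin 2 → ℂ) → (Fin 2 → ℂ) → Prop) : Set L2 :=
  {f | ∃ y : maxFun q, toL2 q y = f ∧
    C ![bvBot w₁ y, bvBot w₂ y] ![bvTop w₁ y, bvTop w₂ y]}

/-- Separated boundary conditions `a α₁ + b α₂ = 0`, `c β₁ + d β₂ = 0`. -/
def separatedDomain (q : ℝ → ℝ) (w₁ w₂ : ℝ → ℂ) (a b c d : ℂ) : Set L2 :=
  bcDomain q w₁ w₂ fun va vb => a * va 0 + b * va 1 = 0 ∧ c * vb 0 + d * vb 1 = 0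

/-- Mixed boundary conditions `(α₁, α₂)ᵀ = M (β₁, β₂)ᵀ`. -/
def alphaOfBetaDomain (q : ℝ → ℝ) (w₁ w₂ : ℝ → ℂ) (M : Matrix (Fin 2) (Fin 2) ℂ) : Set L2 :=
  bcDomain q w₁ w₂ fun va vb => va = M.mulVec vb

/-- Mixed boundary conditions `(β₁, β₂)ᵀ = M (α₁, α₂)ᵀ`. -/
def betaOfAlphaDomain (q : ℝ → ℝ) (w₁ w₂ : ℝ → ℂ) (M : Matrix (Fin 2) (Fin 2) ℂ) : Set L2 :=
  bcDomain q w₁ w₂ fun va vb => vb = M.mulVec va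

/-- The domain given by the normalized separated boundary conditions
`α₁ ξ cos a - α₂ sin a = 0`, `β₁ η cos b - β₂ sin b = 0`. -/
def normalizedSeparatedDomain (q : ℝ → ℝ) (w₁ w₂ : ℝ → ℂ) (ξ η : ℂ) (a b : ℝ) : Set L2 :=
  separatedDomain q w₁ w₂ (ξ * Real.cos a) (-Real.sin a) (η * Real.cos b) (-Real.sin b)

end LimitCircle

end

/-!
Green's identity writes `⟪τ f, g⟫ - ⟪f, τ g⟫` as the difference of the limits of `[f, g]_x` at
`±∞`. By a Plücker relation and `[w₁, w₂] = 1`, these limits depend on `f` and `g` only through the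
boundary values `α`, `β`, by way of the form `conj u₁ v₂ - conj u₂ v₁` on `ℂ²`. In the limit circle
case the solutions `w₁`, `w₂`, cut off near either end, lie in the maximal domain, so the boundary
values `(α, β)` fill `ℂ² × ℂ²`. Variation of parameters solves `τ z = h` on bounded intervals and
shows that a weak solution is a strong one, so `A* = A_max` and `A = A_max*` is the kernel of the
boundary values. An extension between `A` and `A*` therefore corresponds to a subspace of
`ℂ² × ℂ²`, its adjoint to the orthogonal complement of that subspace for the difference of the forms
at `±∞`, and parity exchanges `α` with `β` up to the sign of the second component.

A plane in `ℂ² × ℂ²` is the graph of a linear map over one of the two factors unless it meets both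
factors nontrivially, in which case it is a product of two lines.
-/

noncomputable section

namespace LimitCircle

/-! ### Locally absolutely continuous functions -/

theorem absolutelyContinuousOnInterval_of_dist_le {X Y : Type*} [PseudoMetricSpace X]
    [PseudoMetricSpace Y] {f : ℝ → X} {g : ℝ → Y} {a b : ℝ}
    (hf : AbsolutelyContinuousOnInterval f a b) (h : ∀ x y, dist (g x) (g y) ≤ dist (f x) (f y)) :
    AbsolutelyContinuousOnInterval g a b :=
  squeeze_zero (fun _ => Finset.sum_nonneg fun _ _ => dist_nonneg)
    (fun _ => Finset.sum_le_sum fun _ _ => h _ _) hf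

theorem intervalIntegrable_of_locallyIntegrable {E : Type*} [NormedAddCommGroup E] {f : ℝ → E}
    (hf : LocallyIntegrable f volume) (a b : ℝ) : IntervalIntegrable f volume a b :=
  (hf.integrableOn_isCompact isCompact_uIcc).intervalIntegrable

namespace LocAC

variable {f g : ℝ → ℂ}

theorem continuous (hf : LocAC f) : Continuous f :=
  continuous_iff_continuousAt.2 fun x => (hf (x - 1) (x + 1)).continuousOn.continuousAt <| by
    rw [Set.uIcc_of_le (by linarith)]
    exact Icc_mem_nhds (by linarith) (by linarith)

theorem of_contDiff (hf : ContDiff ℝ 1 f) : LocAC f :=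
  fun _ _ => hf.contDiffOn.absolutelyContinuousOnInterval

theorem add (hf : LocAC f) (hg : LocAC g) : LocAC (f + g) :=
  fun a b => (hf a b).add (hg a b)

theorem neg (hf : LocAC f) : LocAC (-f) :=
  fun a b => (hf a b).neg

theorem sub (hf : LocAC f) (hg : LocAC g) : LocAC (f - g) :=
  fun a b => (hf a b).sub (hg a b)

theorem mul (hf : LocAC f) (hg : LocAC g) : LocAC (f * g) :=
  fun a b => (hf a b).smul (hg a b)

theorem star (hf : LocAC f) : LocAC (star f) :=
  fun a b => absolutelyContinuousOnInterval_of_dist_le (hf a b) fun _ _ =>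
    (Complex.dist_conj_conj _ _).le

theorem comp_neg (hf : LocAC f) : LocAC (fun x => f (-x)) := by
  intro a b
  rw [absolutelyContinuousOnInterval_iff]
  intro ε hε
  obtain ⟨δ, hδ, H⟩ := (absolutelyContinuousOnInterval_iff f (-a) (-b)).1 (hf (-a) (-b)) ε hε
  refine ⟨δ, hδ, fun E hE hs => H (E.1, fun i => (-(E.2 i).1, -(E.2 i).2)) ⟨?_, ?_⟩ ?_⟩
  · intro i hi
    have := hE.1 i hi
    grind [Set.mem_uIcc]
  · intro i hi j hj hij
    simpa only [Function.onFun, Set.uIoc, Set.Ioc_disjoint_Ioc, min_neg_neg, max_neg_neg,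
      neg_le_neg_iff] using hE.2 hi hj hij
  · simpa only [dist_neg_neg] using hs

theorem integral (hf : LocallyIntegrable f volume) (c : ℝ) :
    LocAC (fun x => ∫ t in c..x, f t) := by
  intro a b
  have hint := intervalIntegrable_of_locallyIntegrable hf
  have hc : c ∈ Set.uIcc (min c (min a b)) (max c (max a b)) := by
    grind [Set.mem_uIcc]
  have hsub : Set.uIcc a b ⊆ Set.uIcc (min c (min a b)) (max c (max a b)) := by
    grind [Set.mem_uIcc]
  have hnorm : AbsolutelyContinuousOnInterval (fun x => ∫ t in c..x, ‖f t‖) a b :=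
    ((hint _ _).norm.absolutelyContinuousOnInterval_intervalIntegral hc).mono hsub
  refine absolutelyContinuousOnInterval_of_dist_le hnorm fun x y => ?_
  rw [dist_eq_norm, dist_eq_norm, intervalIntegral.integral_interval_sub_left (hint _ _)
    (hint _ _), intervalIntegral.integral_interval_sub_left (hint _ _).norm (hint _ _).norm]
  exact intervalIntegral.norm_integral_le_abs_integral_norm

theorem eq_of_ae_hasDerivAt_zero (hf : LocAC f) (h : ∀ᵐ x, HasDerivAt f 0 x) (x y : ℝ) :
    f x = f y := by
  obtain ⟨C, hC⟩ := (hf x y).const_of_ae_hasDerivAt_zero (h.mono fun t ht _ => ht)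
  rw [hC x Set.left_mem_uIcc, hC y Set.right_mem_uIcc]

section FundamentalTheorem

variable {F : ℝ → ℂ} (hF : LocAC F) (h : ∀ᵐ x, HasDerivAt F (f x) x)
include hF h

theorem integral_eq_sub (hf : LocallyIntegrable f volume) (a b : ℝ) :
    ∫ t in a..b, f t = F b - F a := by
  have hconst := (hF.sub (LocAC.integral hf a)).eq_of_ae_hasDerivAt_zero (by
    filter_upwards [h, LocallyIntegrable.ae_hasDerivAt_integral hf] with x hx hx'
    exact (hx.sub (hx' a)).congr_deriv (sub_self _)) b a
  simp only [Pi.sub_apply, intervalIntegral.integral_same, sub_zero] at hconst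
  rw [← hconst, sub_sub_cancel]

theorem hasDerivAt_of_continuous (hf : Continuous f) (x : ℝ) : HasDerivAt F (f x) x := by
  have hint : F = fun x => F 0 + ∫ t in (0 : ℝ)..x, f t := by
    ext y
    rw [hF.integral_eq_sub h hf.locallyIntegrable, add_sub_cancel]
  rw [hint]
  exact (hf.integral_hasStrictDerivAt 0 x).hasDerivAt.const_add _

theorem exists_tendsto_atBot (hf : Integrable f volume) : ∃ l, Tendsto F atBot (𝓝 l) := by
  have hlim := intervalIntegral_tendsto_integral_Iic 0 hf.integrableOn tendsto_id
  refine ⟨_, (hlim.const_sub (F 0)).congr fun x => ?_⟩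
  rw [id, hF.integral_eq_sub h hf.locallyIntegrable, sub_sub_cancel]

theorem exists_tendsto_atTop (hf : Integrable f volume) : ∃ l, Tendsto F atTop (𝓝 l) := by
  have hlim := intervalIntegral_tendsto_integral_Ioi 0 hf.integrableOn tendsto_id
  refine ⟨_, (hlim.const_add (F 0)).congr fun x => ?_⟩
  rw [id, hF.integral_eq_sub h hf.locallyIntegrable, add_sub_cancel]

theorem integral_eq_sub_of_tendsto (hf : Integrable f volume) {l m : ℂ}
    (hbot : Tendsto F atBot (𝓝 l)) (htop : Tendsto F atTop (𝓝 m)) : ∫ x, f x = m - l := by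
  have hlim := intervalIntegral_tendsto_integral hf tendsto_neg_atTop_atBot tendsto_id
  refine tendsto_nhds_unique hlim ((htop.sub (hbot.comp tendsto_neg_atTop_atBot)).congr fun x => ?_)
  rw [hF.integral_eq_sub h hf.locallyIntegrable, id, Function.comp_apply]

end FundamentalTheorem

end LocAC

namespace Regular

variable {f g : ℝ → ℂ}

theorem of_hasDerivAt {f' : ℝ → ℂ} (h : ∀ x, HasDerivAt f (f' x) x) (h' : LocAC f') :
    Regular f := by
  have hd : deriv f = f' := funext fun x => (h x).deriv
  have hdiff : Differentiable ℝ f := fun x => (h x).differentiableAt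
  exact ⟨hdiff, LocAC.of_contDiff (contDiff_one_iff_deriv.2 ⟨hdiff, hd ▸ h'.continuous⟩), hd ▸ h'⟩

theorem continuous (hf : Regular f) : Continuous f := hf.diff.continuous

theorem continuous_deriv (hf : Regular f) : Continuous (deriv f) := hf.ac_deriv.continuous

theorem ae_hasDerivAt_deriv (hf : Regular f) (q : ℝ → ℝ) :
    ∀ᵐ x, HasDerivAt (deriv f) (-tau q f x - q x * f x) x := by
  filter_upwards [hf.ac_deriv.ae_differentiableAt] with x hx
  exact hx.hasDerivAt.congr_deriv (by simp only [tau]; ring)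

theorem comp_neg (hf : Regular f) : Regular (fun x => f (-x)) :=
  of_hasDerivAt (fun x => (hf.diff (-x)).hasDerivAt.scomp x (hasDerivAt_neg x) |>.congr_deriv
    (by simp)) hf.ac_deriv.comp_neg.neg

end Regular

theorem tau_ae_eq_of_hasDerivAt {q : ℝ → ℝ} {y y' f : ℝ → ℂ} (h : ∀ x, HasDerivAt y (y' x) x)
    (h' : ∀ᵐ x, HasDerivAt y' (-f x - q x * y x) x) : tau q y =ᵐ[volume] f := by
  have hd : deriv y = y' := funext fun x => (h x).deriv
  filter_upwards [h'] with x hx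
  simp only [tau, hd, hx.deriv]; ring

/-! ### The bracket -/

section Bracket

variable {f g : ℝ → ℂ}

theorem Regular.bracket_locAC (hf : Regular f) (hg : Regular g) : LocAC (bracket f g) :=
  (hf.ac.star.mul hg.ac_deriv).sub (hf.ac_deriv.star.mul hg.ac)

theorem Regular.ae_hasDerivAt_bracket (hf : Regular f) (hg : Regular g) (q : ℝ → ℝ) :
    ∀ᵐ x, HasDerivAt (bracket f g) (conj (tau q f x) * g x - conj (f x) * tau q g x) x := by
  filter_upwards [hf.ae_hasDerivAt_deriv q, hg.ae_hasDerivAt_deriv q] with x hf'' hg''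
  refine (((hf.diff x).hasDerivAt.star.mul hg'').sub
    (hf''.star.mul (hg.diff x).hasDerivAt)).congr_deriv ?_
  simp only [Complex.star_def, map_sub, map_neg, map_mul, Complex.conj_ofReal]
  ring

theorem bracket_add_right {w y z : ℝ → ℂ} (hy : Regular y) (hz : Regular z) :
    bracket w (y + z) = bracket w y + bracket w z := by
  ext x
  simp only [bracket, deriv_add (hy.diff x) (hz.diff x), Pi.add_apply]
  ring

theorem bracket_smul_right {w y : ℝ → ℂ} (c : ℂ) (hy : Regular y) :
    bracket w (c • y) = c • bracket w y := by
  ext x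
  simp only [bracket, deriv_const_smul c (hy.diff x), Pi.smul_apply, smul_eq_mul]
  ring

theorem bracket_neg_left (w y : ℝ → ℂ) : bracket (-w) y = -bracket w y := by
  ext x
  simp only [bracket, deriv.neg, Pi.neg_apply, map_neg]
  ring

theorem bracket_comp_neg (f g : ℝ → ℂ) (x : ℝ) :
    bracket (fun t => f (-t)) (fun t => g (-t)) x = -bracket f g (-x) := by
  simp only [bracket, deriv_comp_neg, map_neg]
  ring

theorem bracket_eq_zero_of_notMem_tsupport {x : ℝ} (hx : x ∉ tsupport g) : bracket f g x = 0 := by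
  have hg := notMem_tsupport_iff_eventuallyEq.1 hx
  simp [bracket, hg.deriv_eq, hg.eq_of_nhds]

theorem tau_eq_zero_of_notMem_tsupport {q : ℝ → ℝ} {x : ℝ} (hx : x ∉ tsupport g) :
    tau q g x = 0 := by
  have hg := notMem_tsupport_iff_eventuallyEq.1 hx
  simp [tau, hg.deriv.deriv_eq, hg.eq_of_nhds]

theorem conj_deriv_of_real {w : ℝ → ℂ} (hw : Differentiable ℝ w) (hreal : ∀ x, (w x).im = 0)
    (x : ℝ) : conj (deriv w x) = deriv w x := by
  have hstar : star w = w := funext fun t => Complex.conj_eq_iff_im.2 (hreal t)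
  have hderiv : HasDerivAt (star w) (star (deriv w x)) x := (hw x).hasDerivAt.star
  exact (hstar ▸ hderiv).deriv.symm

theorem bracket_of_real {w : ℝ → ℂ} (hw : Differentiable ℝ w) (hreal : ∀ x, (w x).im = 0)
    (f : ℝ → ℂ) (x : ℝ) : bracket w f x = w x * deriv f x - deriv w x * f x := by
  rw [bracket, Complex.conj_eq_iff_im.2 (hreal x), conj_deriv_of_real hw hreal]

end Bracket

/-! ### Fundamental systems and variation of parameters -/

/-- A real fundamental system `w₁, w₂` of `τ_q y = 0` whose Wronskian, which is constant, is
normalized to `1`. Unlike for `IsReferencePair`, no symmetry is assumed. -/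
structure IsFundamentalPair (q : ℝ → ℝ) (w₁ w₂ : ℝ → ℂ) : Prop where
  sol₁ : IsSolution q 0 w₁
  sol₂ : IsSolution q 0 w₂
  real₁ : ∀ x, (w₁ x).im = 0
  real₂ : ∀ x, (w₂ x).im = 0
  bracket_eq_one : ∀ x, bracket w₁ w₂ x = 1

theorem IsSolution.bracket_eq {q : ℝ → ℝ} {f g : ℝ → ℂ} (hf : IsSolution q 0 f)
    (hg : IsSolution q 0 g) (x y : ℝ) : bracket f g x = bracket f g y := by
  refine (hf.regular.bracket_locAC hg.regular).eq_of_ae_hasDerivAt_zero ?_ x y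
  filter_upwards [hf.regular.ae_hasDerivAt_bracket hg.regular q, hf.eqn, hg.eqn] with t ht h₁ h₂
  simpa [h₁, h₂] using ht

theorem IsReferencePair.isFundamentalPair {q : ℝ → ℝ} {w₁ w₂ : ℝ → ℂ}
    (hw : IsReferencePair q w₁ w₂) : IsFundamentalPair q w₁ w₂ where
  sol₁ := hw.sol₁
  sol₂ := hw.sol₂
  real₁ := hw.real₁
  real₂ := hw.real₂
  bracket_eq_one x := tendsto_nhds_unique tendsto_const_nhds <|
    hw.bracket_top.congr fun y => hw.sol₁.bracket_eq hw.sol₂ y x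

/-- The solution of `τ_q z = h` with `z c = z' c = 0`, for a fundamental pair `w₁, w₂`. -/
def variation (w₁ w₂ h : ℝ → ℂ) (c x : ℝ) : ℂ :=
  w₁ x * (∫ t in c..x, h t * w₂ t) - w₂ x * ∫ t in c..x, h t * w₁ t

/-- The derivative of `variation w₁ w₂ h c`. -/
def variationDeriv (w₁ w₂ h : ℝ → ℂ) (c x : ℝ) : ℂ :=
  deriv w₁ x * (∫ t in c..x, h t * w₂ t) - deriv w₂ x * ∫ t in c..x, h t * w₁ t

namespace IsFundamentalPair

variable {q : ℝ → ℝ} {w₁ w₂ h : ℝ → ℂ} (hw : IsFundamentalPair q w₁ w₂)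
include hw

theorem bracket_left₁ (f : ℝ → ℂ) (x : ℝ) :
    bracket w₁ f x = w₁ x * deriv f x - deriv w₁ x * f x :=
  bracket_of_real hw.sol₁.regular.diff hw.real₁ f x

theorem bracket_left₂ (f : ℝ → ℂ) (x : ℝ) :
    bracket w₂ f x = w₂ x * deriv f x - deriv w₂ x * f x :=
  bracket_of_real hw.sol₂.regular.diff hw.real₂ f x

theorem wronskian (x : ℝ) : w₁ x * deriv w₂ x - deriv w₁ x * w₂ x = 1 := by
  rw [← hw.bracket_left₁, hw.bracket_eq_one]

theorem bracket_self₁ : bracket w₁ w₁ = 0 := by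
  ext x
  rw [hw.bracket_left₁, Pi.zero_apply]
  ring

theorem bracket_self₂ : bracket w₂ w₂ = 0 := by
  ext x
  rw [hw.bracket_left₂, Pi.zero_apply]
  ring

theorem bracket_swap : bracket w₂ w₁ = -1 := by
  ext x
  rw [hw.bracket_left₂, Pi.neg_apply, Pi.one_apply, ← hw.wronskian x]
  ring

/-- The Plücker identity for the `2 × 2` minors of `(w₁, w₂, f, g)` and their derivatives. -/
theorem bracket_eq (f g : ℝ → ℂ) (x : ℝ) :
    bracket f g x = conj (bracket w₁ f x) * bracket w₂ g x
      - conj (bracket w₂ f x) * bracket w₁ g x := by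
  simp only [bracket, map_sub, map_mul,
    Complex.conj_eq_iff_im.2 (hw.real₁ x), Complex.conj_eq_iff_im.2 (hw.real₂ x),
    conj_deriv_of_real hw.sol₁.regular.diff hw.real₁,
    conj_deriv_of_real hw.sol₂.regular.diff hw.real₂]
  linear_combination -(conj (f x) * deriv g x - conj (deriv f x) * g x) * hw.wronskian x

section Variation

variable (hh : LocallyIntegrable h volume) (c : ℝ)
include hh

theorem variationDeriv_locAC : LocAC (variationDeriv w₁ w₂ h c) :=
  (hw.sol₁.regular.ac_deriv.mul (.integral (hh.mul_continuous hw.sol₂.regular.continuous) c)).sub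
  (hw.sol₂.regular.ac_deriv.mul (.integral (hh.mul_continuous hw.sol₁.regular.continuous) c))

theorem ae_hasDerivAt_integral_mul : ∀ᵐ x,
    HasDerivAt (fun x => ∫ t in c..x, h t * w₁ t) (h x * w₁ x) x ∧
    HasDerivAt (fun x => ∫ t in c..x, h t * w₂ t) (h x * w₂ x) x := by
  filter_upwards [LocallyIntegrable.ae_hasDerivAt_integral
      (hh.mul_continuous hw.sol₁.regular.continuous),
    LocallyIntegrable.ae_hasDerivAt_integral
      (hh.mul_continuous hw.sol₂.regular.continuous)] with x h₁ h₂
  exact ⟨h₁ c, h₂ c⟩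

theorem hasDerivAt_variation (x : ℝ) :
    HasDerivAt (variation w₁ w₂ h c) (variationDeriv w₁ w₂ h c x) x := by
  have hac : LocAC (variation w₁ w₂ h c) :=
    (hw.sol₁.regular.ac.mul (.integral (hh.mul_continuous hw.sol₂.regular.continuous) c)).sub
    (hw.sol₂.regular.ac.mul (.integral (hh.mul_continuous hw.sol₁.regular.continuous) c))
  refine hac.hasDerivAt_of_continuous ?_ (hw.variationDeriv_locAC hh c).continuous x
  filter_upwards [hw.ae_hasDerivAt_integral_mul hh c] with t ⟨h₁, h₂⟩
  refine (((hw.sol₁.regular.diff t).hasDerivAt.mul h₂).sub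
    ((hw.sol₂.regular.diff t).hasDerivAt.mul h₁)).congr_deriv ?_
  rw [variationDeriv]
  ring

theorem regular_variation : Regular (variation w₁ w₂ h c) :=
  .of_hasDerivAt (hw.hasDerivAt_variation hh c) (hw.variationDeriv_locAC hh c)

theorem tau_variation : tau q (variation w₁ w₂ h c) =ᵐ[volume] h := by
  refine tau_ae_eq_of_hasDerivAt (hw.hasDerivAt_variation hh c) ?_
  filter_upwards [hw.ae_hasDerivAt_integral_mul hh c, hw.sol₁.regular.ae_hasDerivAt_deriv q,
    hw.sol₂.regular.ae_hasDerivAt_deriv q, hw.sol₁.eqn, hw.sol₂.eqn] with t ⟨h₁, h₂⟩ d₁ d₂ e₁ e₂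
  refine ((d₁.mul h₂).sub (d₂.mul h₁)).congr_deriv ?_
  simp only [variation, e₁, e₂]
  linear_combination -h t * hw.wronskian t

end Variation

end IsFundamentalPair

/-! ### Cutting off a solution -/

/-- A smooth function, equal to `0` on `(-∞, 0]` and to `1` on `[1, ∞)`, which localizes the
solutions of `τ_q y = 0` to a neighbourhood of `+∞`. -/
def cutoff (x : ℝ) : ℂ := Real.smoothTransition x

theorem contDiff_cutoff {n : ℕ∞} : ContDiff ℝ n cutoff :=
  Complex.ofRealCLM.contDiff.comp Real.smoothTransition.contDiff

theorem cutoff_of_nonpos {x : ℝ} (hx : x ≤ 0) : cutoff x = 0 := by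
  simp [cutoff, Real.smoothTransition.zero_of_nonpos hx]

theorem cutoff_of_one_le {x : ℝ} (hx : 1 ≤ x) : cutoff x = 1 := by
  simp [cutoff, Real.smoothTransition.one_of_one_le hx]

theorem norm_cutoff_le_one (x : ℝ) : ‖cutoff x‖ ≤ 1 := by
  rw [cutoff, Complex.norm_real, Real.norm_of_nonneg (Real.smoothTransition.nonneg x)]
  exact Real.smoothTransition.le_one x

theorem contDiff_deriv_cutoff : ContDiff ℝ 1 (deriv cutoff) :=
  (contDiff_succ_iff_deriv.1 (contDiff_cutoff (n := 2))).2.2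

theorem hasCompactSupport_deriv_cutoff : HasCompactSupport (deriv cutoff) := by
  refine .intro (isCompact_Icc (a := 0) (b := 1)) fun x hx => ?_
  rw [Set.mem_Icc, not_and_or, not_le, not_le] at hx
  rcases hx with hx | hx
  · have hloc : cutoff =ᶠ[𝓝 x] fun _ => 0 := by
      filter_upwards [Iio_mem_nhds hx] with y hy using cutoff_of_nonpos (le_of_lt hy)
    rw [hloc.deriv_eq, deriv_const]
  · have hloc : cutoff =ᶠ[𝓝 x] fun _ => 1 := by
      filter_upwards [Ioi_mem_nhds hx] with y hy using cutoff_of_one_le (le_of_lt hy)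
    rw [hloc.deriv_eq, deriv_const]

/-- The value `-χ'' y - 2 χ' y'` of `τ_q (χ y)`, for the cutoff `χ` and a solution `y` of
`τ_q y = 0`. -/
def cutoffTau (y : ℝ → ℂ) (x : ℝ) : ℂ :=
  -(deriv (deriv cutoff) x * y x + 2 * (deriv cutoff x * deriv y x))

section Cutoff

variable {q : ℝ → ℝ} {y : ℝ → ℂ}

theorem Regular.hasDerivAt_cutoff_mul (hy : Regular y) (x : ℝ) :
    HasDerivAt (cutoff * y) (deriv cutoff x * y x + cutoff x * deriv y x) x :=
  (contDiff_cutoff.differentiable one_ne_zero x).hasDerivAt.mul (hy.diff x).hasDerivAt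

theorem Regular.cutoff_mul (hy : Regular y) : Regular (cutoff * y) :=
  .of_hasDerivAt hy.hasDerivAt_cutoff_mul <|
    ((LocAC.of_contDiff contDiff_deriv_cutoff).mul hy.ac).add
      ((LocAC.of_contDiff contDiff_cutoff).mul hy.ac_deriv)

theorem IsSolution.tau_cutoff_mul (hy : IsSolution q 0 y) :
    tau q (cutoff * y) =ᵐ[volume] cutoffTau y := by
  refine tau_ae_eq_of_hasDerivAt hy.regular.hasDerivAt_cutoff_mul ?_
  filter_upwards [hy.regular.ae_hasDerivAt_deriv q, hy.eqn] with x hy'' heqn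
  have hχ := (contDiff_cutoff.differentiable one_ne_zero x).hasDerivAt
  have hχ' := (contDiff_deriv_cutoff.differentiable one_ne_zero x).hasDerivAt
  refine ((hχ'.mul (hy.regular.diff x).hasDerivAt).add (hχ.mul hy'')).congr_deriv ?_
  rw [heqn, cutoffTau, Pi.mul_apply]
  ring

theorem Regular.continuous_cutoffTau (hy : Regular y) : Continuous (cutoffTau y) := by
  have hχ'' := contDiff_deriv_cutoff.continuous_deriv le_rfl
  have hχ' := contDiff_deriv_cutoff.continuous
  have := hy.continuous
  have := hy.continuous_deriv
  unfold cutoffTau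
  fun_prop

theorem hasCompactSupport_cutoffTau (y : ℝ → ℂ) : HasCompactSupport (cutoffTau y) :=
  have h := hasCompactSupport_deriv_cutoff
  ((h.deriv.mul_right (f' := y)).add (h.mul_right (f' := deriv y)).mul_left).neg

theorem Regular.memLp_cutoffTau (hy : Regular y) : MemLp (cutoffTau y) 2 volume :=
  hy.continuous_cutoffTau.memLp_of_hasCompactSupport (hasCompactSupport_cutoffTau y)

theorem IsSolution.cutoff_mul_mem_maxFun (hy : IsSolution q 0 y) (hmem : MemLp y 2 volume) :
    cutoff * y ∈ maxFun q := by
  refine ⟨hy.regular.cutoff_mul, ?_, hy.regular.memLp_cutoffTau.ae_eq hy.tau_cutoff_mul.symm⟩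
  refine hmem.of_le hy.regular.cutoff_mul.continuous.aestronglyMeasurable
    (ae_of_all _ fun x => ?_)
  rw [Pi.mul_apply, norm_mul]
  exact mul_le_of_le_one_left (norm_nonneg _) (norm_cutoff_le_one x)

end Cutoff

/-! ### Boundary values -/

section L2

variable {f g : ℝ → ℂ}

theorem inner_toLp (hf : MemLp f 2 volume) (hg : MemLp g 2 volume) :
    inner ℂ (hf.toLp f : L2) (hg.toLp g) = ∫ x, conj (f x) * g x := by
  rw [L2.inner_def]
  refine integral_congr_ae ?_
  filter_upwards [hf.coeFn_toLp, hg.coeFn_toLp] with x hfx hgx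
  rw [hfx, hgx, RCLike.inner_apply, mul_comm]

theorem integrable_conj_mul (hf : MemLp f 2 volume) (hg : MemLp g 2 volume) :
    Integrable (fun x => conj (f x) * g x) volume :=
  hf.star.integrable_mul hg

end L2

section Maximal

variable {q : ℝ → ℝ}

theorem IsSolution.mem_maxFun {w : ℝ → ℂ} (hw : IsSolution q 0 w) (hTop : IsLimitCircleTop q)
    (hBot : IsLimitCircleBot q) : w ∈ maxFun q := by
  refine ⟨hw.regular, ?_, MemLp.zero.ae_eq ?_⟩
  · obtain ⟨a, ha⟩ := hTop 0 w hw
    obtain ⟨b, hb⟩ := hBot 0 w hw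
    have hcont := hw.regular.continuous
    rw [memLp_two_iff_integrable_sq_norm hcont.aestronglyMeasurable] at ha hb ⊢
    have hmid : IntegrableOn (fun x => ‖w x‖ ^ 2) (Set.Icc b a) volume :=
      (hcont.norm.pow 2).integrableOn_Icc
    refine integrableOn_univ.1 (((IntegrableOn.union ha hb).union hmid).mono_set fun x _ => ?_)
    grind
  · filter_upwards [hw.eqn] with x hx
    simp [hx]

theorem integrable_deriv_bracket (f g : maxFun q) : Integrable
    (fun x => conj (tau q f x) * (g : ℝ → ℂ) x - conj ((f : ℝ → ℂ) x) * tau q g x) volume :=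
  (integrable_conj_mul f.2.2.2 g.2.2.1).sub (integrable_conj_mul f.2.2.1 g.2.2.2)

theorem tendsto_bvBot (f g : maxFun q) : Tendsto (bracket f g) atBot (𝓝 (bvBot f g)) :=
  tendsto_nhds_limUnder <| (f.2.1.bracket_locAC g.2.1).exists_tendsto_atBot
    (f.2.1.ae_hasDerivAt_bracket g.2.1 q) (integrable_deriv_bracket f g)

theorem tendsto_bvTop (f g : maxFun q) : Tendsto (bracket f g) atTop (𝓝 (bvTop f g)) :=
  tendsto_nhds_limUnder <| (f.2.1.bracket_locAC g.2.1).exists_tendsto_atTop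
    (f.2.1.ae_hasDerivAt_bracket g.2.1 q) (integrable_deriv_bracket f g)

theorem inner_tauL2_sub_inner_toL2 (f g : maxFun q) :
    inner ℂ (tauL2 q f) (toL2 q g) - inner ℂ (toL2 q f) (tauL2 q g) = bvTop f g - bvBot f g := by
  have h₁ : inner ℂ (tauL2 q f) (toL2 q g) = _ := inner_toLp f.2.2.2 g.2.2.1
  have h₂ : inner ℂ (toL2 q f) (tauL2 q g) = _ := inner_toLp f.2.2.1 g.2.2.2
  rw [h₁, h₂, ← integral_sub (integrable_conj_mul f.2.2.2 g.2.2.1)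
    (integrable_conj_mul f.2.2.1 g.2.2.2)]
  exact (f.2.1.bracket_locAC g.2.1).integral_eq_sub_of_tendsto
    (f.2.1.ae_hasDerivAt_bracket g.2.1 q) (integrable_deriv_bracket f g)
    (tendsto_bvBot f g) (tendsto_bvTop f g)

theorem bvBot_add (f g h : maxFun q) : bvBot f (g + h : maxFun q) = bvBot f g + bvBot f h :=
  tendsto_nhds_unique (tendsto_bvBot f (g + h)) <| by
    rw [Submodule.coe_add, bracket_add_right g.2.1 h.2.1]
    exact (tendsto_bvBot f g).add (tendsto_bvBot f h)

theorem bvTop_add (f g h : maxFun q) : bvTop f (g + h : maxFun q) = bvTop f g + bvTop f h :=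
  tendsto_nhds_unique (tendsto_bvTop f (g + h)) <| by
    rw [Submodule.coe_add, bracket_add_right g.2.1 h.2.1]
    exact (tendsto_bvTop f g).add (tendsto_bvTop f h)

theorem bvBot_smul (c : ℂ) (f g : maxFun q) : bvBot f (c • g : maxFun q) = c * bvBot f g :=
  tendsto_nhds_unique (tendsto_bvBot f (c • g)) <| by
    rw [Submodule.coe_smul, bracket_smul_right c g.2.1]
    exact (tendsto_bvBot f g).const_smul c

theorem bvTop_smul (c : ℂ) (f g : maxFun q) : bvTop f (c • g : maxFun q) = c * bvTop f g :=
  tendsto_nhds_unique (tendsto_bvTop f (c • g)) <| by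
    rw [Submodule.coe_smul, bracket_smul_right c g.2.1]
    exact (tendsto_bvTop f g).const_smul c

/-- The boundary values `((α₁, α₂), (β₁, β₂))`, `αⱼ = [wⱼ, y]_{-∞}` and `βⱼ = [wⱼ, y]_{+∞}`, of
an element `y` of the maximal domain. -/
def boundary (w₁ w₂ : maxFun q) : maxFun q →ₗ[ℂ] (Fin 2 → ℂ) × (Fin 2 → ℂ) where
  toFun y := (![bvBot w₁ y, bvBot w₂ y], ![bvTop w₁ y, bvTop w₂ y])
  map_add' y z := by simp only [bvBot_add, bvTop_add, Prod.mk_add_mk,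
    Matrix.cons_add_cons, Matrix.empty_add_empty]
  map_smul' c y := by simp only [bvBot_smul, bvTop_smul, RingHom.id_apply, Prod.smul_mk,
    Matrix.smul_cons, Matrix.smul_empty, smul_eq_mul]

/-- The form `conj u₁ v₂ - conj u₂ v₁` on `ℂ²`, through which `[f, g]_{±∞}` depends on the boundary
values of `f` and `g`. -/
def boundaryForm (u v : Fin 2 → ℂ) : ℂ := conj (u 0) * v 1 - conj (u 1) * v 0

variable {w₁ w₂ : maxFun q} (hw : IsFundamentalPair q w₁ w₂)

namespace IsFundamentalPair

include hw

theorem bvBot_eq (f g : maxFun q) :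
    bvBot f g = boundaryForm (boundary w₁ w₂ f).1 (boundary w₁ w₂ g).1 := by
  refine tendsto_nhds_unique (tendsto_bvBot f g)
    (Tendsto.congr (fun x => (hw.bracket_eq f g x).symm) ?_)
  exact ((tendsto_bvBot w₁ f).star.mul (tendsto_bvBot w₂ g)).sub
    ((tendsto_bvBot w₂ f).star.mul (tendsto_bvBot w₁ g))

theorem bvTop_eq (f g : maxFun q) :
    bvTop f g = boundaryForm (boundary w₁ w₂ f).2 (boundary w₁ w₂ g).2 := by
  refine tendsto_nhds_unique (tendsto_bvTop f g)
    (Tendsto.congr (fun x => (hw.bracket_eq f g x).symm) ?_)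
  exact ((tendsto_bvTop w₁ f).star.mul (tendsto_bvTop w₂ g)).sub
    ((tendsto_bvTop w₂ f).star.mul (tendsto_bvTop w₁ g))

theorem boundary_left : boundary w₁ w₂ w₁ = (![0, -1], ![0, -1]) := by
  simp [boundary, bvBot, bvTop, hw.bracket_self₁, hw.bracket_swap, Pi.zero_def, Pi.neg_def,
    tendsto_const_nhds.limUnder_eq]

theorem boundary_right : boundary w₁ w₂ w₂ = (![1, 0], ![1, 0]) := by
  simp [boundary, bvBot, bvTop, hw.bracket_self₂, funext hw.bracket_eq_one, Pi.zero_def,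
    tendsto_const_nhds.limUnder_eq]

end IsFundamentalPair

theorem bracket_eventuallyEq_atBot {w y z : ℝ → ℂ} (h : y =ᶠ[atBot] z) :
    bracket w y =ᶠ[atBot] bracket w z := by
  obtain ⟨a, ha⟩ := eventually_atBot.1 h
  filter_upwards [eventually_lt_atBot a] with x hx
  have hloc : y =ᶠ[𝓝 x] z := by
    filter_upwards [Iio_mem_nhds hx] with t ht using ha t (le_of_lt ht)
  rw [bracket, bracket, hloc.deriv_eq, hloc.eq_of_nhds]

theorem bracket_eventuallyEq_atTop {w y z : ℝ → ℂ} (h : y =ᶠ[atTop] z) :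
    bracket w y =ᶠ[atTop] bracket w z := by
  obtain ⟨a, ha⟩ := eventually_atTop.1 h
  filter_upwards [eventually_gt_atTop a] with x hx
  have hloc : y =ᶠ[𝓝 x] z := by
    filter_upwards [Ioi_mem_nhds hx] with t ht using ha t (le_of_lt ht)
  rw [bracket, bracket, hloc.deriv_eq, hloc.eq_of_nhds]

theorem boundary_fst_congr {y z : maxFun q} (h : (y : ℝ → ℂ) =ᶠ[atBot] z) :
    (boundary w₁ w₂ y).1 = (boundary w₁ w₂ z).1 := by
  simp [boundary, bvBot, limUnder, Filter.map_congr (bracket_eventuallyEq_atBot h)]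

theorem boundary_snd_congr {y z : maxFun q} (h : (y : ℝ → ℂ) =ᶠ[atTop] z) :
    (boundary w₁ w₂ y).2 = (boundary w₁ w₂ z).2 := by
  simp [boundary, bvTop, limUnder, Filter.map_congr (bracket_eventuallyEq_atTop h)]

theorem boundary_eq_zero_of_hasCompactSupport {y : maxFun q}
    (hy : HasCompactSupport (y : ℝ → ℂ)) : boundary w₁ w₂ y = 0 := by
  have h : (y : ℝ → ℂ) =ᶠ[cocompact ℝ] (0 : maxFun q) := by
    rw [← coclosedCompact_eq_cocompact]
    exact hasCompactSupport_iff_eventuallyEq.1 hy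
  rw [← map_zero (boundary w₁ w₂)]
  exact Prod.ext (boundary_fst_congr (h.filter_mono atBot_le_cocompact))
    (boundary_snd_congr (h.filter_mono atTop_le_cocompact))

theorem exists_boundary_eq_zero_prod {y : maxFun q} (hy : IsSolution q 0 y) :
    ∃ z : maxFun q, boundary w₁ w₂ z = (0, (boundary w₁ w₂ y).2) := by
  refine ⟨⟨_, hy.cutoff_mul_mem_maxFun y.2.2.1⟩, Prod.ext ?_ (boundary_snd_congr ?_)⟩
  · refine (boundary_fst_congr (z := 0) ?_).trans (by rw [map_zero]; rfl)
    filter_upwards [eventually_le_atBot 0] with x hx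
    simp [cutoff_of_nonpos hx]
  · filter_upwards [eventually_ge_atTop 1] with x hx
    simp [cutoff_of_one_le hx]

include hw in
theorem IsFundamentalPair.boundary_surjective : Function.Surjective (boundary w₁ w₂) := by
  obtain ⟨z₁, h₁⟩ := exists_boundary_eq_zero_prod (w₁ := w₁) (w₂ := w₂) hw.sol₁
  obtain ⟨z₂, h₂⟩ := exists_boundary_eq_zero_prod (w₁ := w₁) (w₂ := w₂) hw.sol₂
  rintro ⟨a, b⟩
  refine ⟨(-a 1) • w₁ + a 0 • w₂ + (a 1 - b 1) • z₁ + (b 0 - a 0) • z₂, ?_⟩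
  simp only [map_add, map_smul, h₁, h₂, hw.boundary_left, hw.boundary_right]
  ext i <;> fin_cases i <;> simp

end Maximal

/-! ### Weak solutions -/

section Weak

variable {q : ℝ → ℝ} {w₁ w₂ : ℝ → ℂ}

theorem integrable_conj_mul_tau {z : ℝ → ℂ} (hz : Continuous z) {y : maxFun q}
    (hy : HasCompactSupport (y : ℝ → ℂ)) :
    Integrable (fun x => conj (z x) * tau q y x) volume := by
  have hloc : LocallyIntegrable (fun x => conj (z x) * tau q y x) volume :=
    (y.2.2.2.locallyIntegrable one_le_two).continuous_mul hz.star
  refine (integrableOn_iff_integrable_of_support_subset fun x hx => ?_).1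
    (hloc.integrableOn_isCompact hy.isCompact)
  contrapose! hx
  simp [tau_eq_zero_of_notMem_tsupport hx]

theorem Regular.integral_conj_mul_tau {z : ℝ → ℂ} (hz : Regular z)
    (hτz : MemLp (tau q z) 2 volume) {y : maxFun q} (hy : HasCompactSupport (y : ℝ → ℂ)) :
    ∫ x, conj (z x) * tau q y x = ∫ x, conj (tau q z x) * (y : ℝ → ℂ) x := by
  have hzero : bracket z y =ᶠ[cocompact ℝ] 0 := by
    filter_upwards [hy.isCompact.compl_mem_cocompact] with x hx
    exact bracket_eq_zero_of_notMem_tsupport hx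
  have hint₁ := integrable_conj_mul hτz y.2.2.1
  have hint₂ := integrable_conj_mul_tau hz.continuous hy
  have hgreen := (hz.bracket_locAC y.2.1).integral_eq_sub_of_tendsto
    (hz.ae_hasDerivAt_bracket y.2.1 q) (hint₁.sub hint₂)
    ((tendsto_const_nhds (x := (0 : ℂ))).congr' (hzero.filter_mono atBot_le_cocompact).symm)
    ((tendsto_const_nhds (x := (0 : ℂ))).congr' (hzero.filter_mono atTop_le_cocompact).symm)
  rw [integral_sub hint₁ hint₂, sub_self, sub_eq_zero] at hgreen
  exact hgreen.symm

theorem tau_add_smul_add_smul {y z z' : ℝ → ℂ} (hy : Regular y) (hz : Regular z)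
    (hz' : Regular z') (c d : ℂ) :
    tau q (y + c • z + d • z') =ᵐ[volume] tau q y + c • tau q z + d • tau q z' := by
  filter_upwards [tau_add q (hy.add (hz.smul c)) (hz'.smul d), tau_add q hy (hz.smul c),
    tau_smul q c hz, tau_smul q d hz'] with x h₁ h₂ h₃ h₄
  simp only [Pi.add_apply] at h₁ h₂ ⊢
  rw [h₁, h₂, h₃, h₄]

theorem variation_eq_zero_of_le {f : ℝ → ℂ} {a b x : ℝ} (hf : Function.support f ⊆ Set.Ioc a b)
    (hx : x ≤ a) : variation w₁ w₂ f a x = 0 := by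
  have hzero (w : ℝ → ℂ) : ∫ t in a..x, f t * w t = 0 := by
    refine intervalIntegral.integral_zero_ae (ae_of_all _ fun t ht => ?_)
    rw [Set.uIoc_of_ge hx] at ht
    have : t ∉ Function.support f := fun h => (hf h).1.not_ge ht.2
    rw [Function.notMem_support.1 this, zero_mul]
  simp [variation, hzero]

theorem variation_eq_of_ge {f : ℝ → ℂ} {a b x : ℝ} (hf : Function.support f ⊆ Set.Ioc a b)
    (hx : b ≤ x) : variation w₁ w₂ f a x =
      w₁ x * (∫ t, f t * w₂ t) - w₂ x * ∫ t, f t * w₁ t := by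
  have hfull (w : ℝ → ℂ) : ∫ t in a..x, f t * w t = ∫ t, f t * w t :=
    intervalIntegral.integral_eq_integral_of_support_subset <|
      (Function.support_mul_subset_left f w).trans <| hf.trans <| Set.Ioc_subset_Ioc_right hx
  simp only [variation, hfull]

/-- For `f` supported in `(a, b]`, the solution of `τ_q y = f` vanishing on `(-∞, a]` is a linear
combination of `w₁` and `w₂` on `[b, ∞)`; subtracting this combination of the cut-off solutions
yields a function of compact support. -/
def truncatedVariation (w₁ w₂ f : ℝ → ℂ) (a : ℝ) : ℝ → ℂ :=
  variation w₁ w₂ f a + (-∫ t, f t * w₂ t) • (cutoff * w₁) + (∫ t, f t * w₁ t) • (cutoff * w₂)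

theorem hasCompactSupport_truncatedVariation {f : ℝ → ℂ} {a b : ℝ}
    (hf : Function.support f ⊆ Set.Ioc a b) :
    HasCompactSupport (truncatedVariation w₁ w₂ f a) := by
  refine .intro (isCompact_Icc (a := min a 0) (b := max b 1)) fun x hx => ?_
  rw [Set.mem_Icc, not_and_or, not_le, not_le, lt_min_iff, max_lt_iff] at hx
  simp only [truncatedVariation, Pi.add_apply, Pi.smul_apply, Pi.mul_apply, smul_eq_mul]
  rcases hx with ⟨ha, h0⟩ | ⟨hb, h1⟩
  · rw [variation_eq_zero_of_le hf ha.le, cutoff_of_nonpos h0.le]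
    ring
  · rw [variation_eq_of_ge hf hb.le, cutoff_of_one_le h1.le]
    ring

namespace IsFundamentalPair

variable (hw : IsFundamentalPair q w₁ w₂)
include hw

theorem exists_tau_eq {f : ℝ → ℂ} (hf : Continuous f) (hs : HasCompactSupport f) :
    ∃ y : maxFun q, HasCompactSupport (y : ℝ → ℂ) ∧ tau q y =ᵐ[volume]
      f + (-∫ t, f t * w₂ t) • cutoffTau w₁ + (∫ t, f t * w₁ t) • cutoffTau w₂ := by
  obtain ⟨r, hr⟩ := hs.isCompact.isBounded.subset_ball 0
  rw [Real.ball_eq_Ioo] at hr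
  have hsupp := ((subset_tsupport f).trans hr).trans Set.Ioo_subset_Ioc_self
  have hvar := hw.regular_variation (hf.locallyIntegrable (μ := volume)) (0 - r)
  have hcut₁ := hw.sol₁.regular.cutoff_mul
  have hcut₂ := hw.sol₂.regular.cutoff_mul
  have hreg : Regular (truncatedVariation w₁ w₂ f (0 - r)) :=
    (hvar.add (hcut₁.smul _)).add (hcut₂.smul _)
  have hcpt := hasCompactSupport_truncatedVariation (w₁ := w₁) (w₂ := w₂) hsupp
  have hτ : tau q (truncatedVariation w₁ w₂ f (0 - r)) =ᵐ[volume] _ :=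
    (tau_add_smul_add_smul hvar hcut₁ hcut₂ _ _).trans <|
      ((hw.tau_variation hf.locallyIntegrable _).add
        (hw.sol₁.tau_cutoff_mul.const_smul _)).add (hw.sol₂.tau_cutoff_mul.const_smul _)
  refine ⟨⟨_, hreg, hreg.continuous.memLp_of_hasCompactSupport hcpt, ?_⟩, hcpt, hτ⟩
  exact (((hf.memLp_of_hasCompactSupport hs).add (hw.sol₁.regular.memLp_cutoffTau.const_smul _)).add
    (hw.sol₂.regular.memLp_cutoffTau.const_smul _)).ae_eq hτ.symm

theorem integral_mul_eq_of_integral_mul_tau_eq_zero {u : ℝ → ℂ} (hu : LocallyIntegrable u volume)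
    (h : ∀ y : maxFun q, HasCompactSupport (y : ℝ → ℂ) → ∫ x, u x * tau q y x = 0)
    {f : ℝ → ℂ} (hf : Continuous f) (hs : HasCompactSupport f) :
    ∫ x, f x * u x = (∫ x, f x * w₂ x) * (∫ x, cutoffTau w₁ x * u x)
      - (∫ x, f x * w₁ x) * ∫ x, cutoffTau w₂ x * u x := by
  obtain ⟨y, hy, hτ⟩ := hw.exists_tau_eq hf hs
  have hint {k : ℝ → ℂ} (hk : Continuous k) (hks : HasCompactSupport k) :
      Integrable (fun x => k x * u x) volume :=
    hu.integrable_smul_left_of_hasCompactSupport hk hks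
  have hint₁ := hint hw.sol₁.regular.continuous_cutoffTau (hasCompactSupport_cutoffTau w₁)
  have hint₂ := hint hw.sol₂.regular.continuous_cutoffTau (hasCompactSupport_cutoffTau w₂)
  set c := -∫ t, f t * w₂ t with hc
  set d := ∫ t, f t * w₁ t
  have hint₀₁ : Integrable (fun x => f x * u x + c * (cutoffTau w₁ x * u x)) volume :=
    (hint hf hs).add (hint₁.const_mul c)
  have hexpand : ∫ x, u x * tau q y x = ∫ x, f x * u x + c * (cutoffTau w₁ x * u x)
      + d * (cutoffTau w₂ x * u x) := by
    refine integral_congr_ae (hτ.mono fun x hx => ?_)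
    simp only [hx, Pi.add_apply, Pi.smul_apply, smul_eq_mul]
    ring
  rw [h y hy, integral_add hint₀₁ (hint₂.const_mul d), integral_add (hint hf hs)
    (hint₁.const_mul c), integral_const_mul, integral_const_mul, hc] at hexpand
  linear_combination -hexpand

theorem exists_ae_eq_of_integral_mul_tau_eq_zero {u : ℝ → ℂ} (hu : LocallyIntegrable u volume)
    (h : ∀ y : maxFun q, HasCompactSupport (y : ℝ → ℂ) → ∫ x, u x * tau q y x = 0) :
    ∃ c d : ℂ, u =ᵐ[volume] c • w₁ + d • w₂ := by
  have hcont₁ := hw.sol₁.regular.continuous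
  have hcont₂ := hw.sol₂.regular.continuous
  set c := -∫ x, cutoffTau w₂ x * u x
  set d := ∫ x, cutoffTau w₁ x * u x
  have hcont : Continuous (c • w₁ + d • w₂) := (hcont₁.const_smul c).add (hcont₂.const_smul d)
  refine ⟨c, d, ae_eq_of_integral_contDiff_smul_eq hu hcont.locallyIntegrable fun g hg hgs => ?_⟩
  have hf : Continuous (fun x => (g x : ℂ)) := Complex.continuous_ofReal.comp hg.continuous
  have hfs : HasCompactSupport (fun x => (g x : ℂ)) := hgs.comp_left Complex.ofReal_zero
  have hint {w : ℝ → ℂ} (hwc : Continuous w) : Integrable (fun x => (g x : ℂ) * w x) volume :=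
    (hf.mul hwc).integrable_of_hasCompactSupport hfs.mul_right
  have hcomb : ∫ x, g x • (c • w₁ + d • w₂) x =
      c * (∫ x, g x * w₁ x) + d * ∫ x, g x * w₂ x := by
    rw [← integral_const_mul, ← integral_const_mul,
      ← integral_add ((hint hcont₁).const_mul c) ((hint hcont₂).const_mul d)]
    refine integral_congr_ae (ae_of_all _ fun x => ?_)
    simp only [Pi.add_apply, Pi.smul_apply, Complex.real_smul, smul_eq_mul]
    ring
  have hu_eq := hw.integral_mul_eq_of_integral_mul_tau_eq_zero hu h hf hfs
  simp only [Complex.real_smul] at hcomb ⊢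
  rw [hcomb, hu_eq]
  ring

end IsFundamentalPair

theorem exists_maxFun_of_ae_eq {g h : L2} {y : ℝ → ℂ} (hy : Regular y) (hg : g =ᵐ[volume] y)
    (hh : tau q y =ᵐ[volume] h) : ∃ Y : maxFun q, toL2 q Y = g ∧ tauL2 q Y = h := by
  have hyL2 := (Lp.memLp g).ae_eq hg
  have hτL2 := (Lp.memLp h).ae_eq hh.symm
  exact ⟨⟨y, hy, hyL2, hτL2⟩, Lp.ext (hyL2.coeFn_toLp.trans hg.symm),
    Lp.ext (hτL2.coeFn_toLp.trans hh)⟩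

theorem inner_eq_integral_of_memLp (g : L2) {f : ℝ → ℂ} (hf : MemLp f 2 volume) :
    inner ℂ g (hf.toLp f) = ∫ x, conj (g x) * f x := by
  simpa only [Lp.toLp_coeFn] using inner_toLp (Lp.memLp g) hf

theorem IsFundamentalPair.exists_of_inner_tauL2_eq (hw : IsFundamentalPair q w₁ w₂) {g h : L2}
    (H : ∀ y : maxFun q, HasCompactSupport (y : ℝ → ℂ) →
      inner ℂ h (toL2 q y) = inner ℂ g (tauL2 q y)) :
    ∃ y : maxFun q, toL2 q y = g ∧ tauL2 q y = h := by
  have hh := (Lp.memLp h).locallyIntegrable one_le_two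
  have hz : Regular (variation w₁ w₂ h 0) := hw.regular_variation hh 0
  have hτz : tau q (variation w₁ w₂ h 0) =ᵐ[volume] h := hw.tau_variation hh 0
  generalize variation w₁ w₂ h 0 = z at hz hτz
  have hu : LocallyIntegrable (star (g : ℝ → ℂ) - star z) volume :=
    ((Lp.memLp g).star.locallyIntegrable one_le_two).sub hz.continuous.star.locallyIntegrable
  obtain ⟨c, d, hcd⟩ := hw.exists_ae_eq_of_integral_mul_tau_eq_zero hu fun y hy => by
    have hweak : ∫ x, conj (g x) * tau q y x = ∫ x, conj (h x) * (y : ℝ → ℂ) x := by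
      rw [← inner_eq_integral_of_memLp g y.2.2.2, ← inner_eq_integral_of_memLp h y.2.2.1]
      exact (H y hy).symm
    have hz_weak : ∫ x, conj (z x) * tau q y x = ∫ x, conj (h x) * (y : ℝ → ℂ) x := by
      rw [hz.integral_conj_mul_tau ((Lp.memLp h).ae_eq hτz.symm) hy]
      exact integral_congr_ae (hτz.mono fun x hx => by simp only [hx])
    simp only [Pi.sub_apply, Pi.star_apply, Complex.star_def, sub_mul]
    rw [integral_sub (integrable_conj_mul (Lp.memLp g) y.2.2.2)
      (integrable_conj_mul_tau hz.continuous hy), hweak, hz_weak, sub_self]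
  refine exists_maxFun_of_ae_eq (y := z + conj c • w₁ + conj d • w₂)
    ((hz.add (hw.sol₁.regular.smul _)).add (hw.sol₂.regular.smul _)) ?_ ?_
  · filter_upwards [hcd] with x hx
    have hx' := congrArg conj hx
    simp only [Pi.sub_apply, Pi.star_apply, Complex.star_def, Pi.add_apply, Pi.smul_apply,
      smul_eq_mul, map_sub, map_add, map_mul, Complex.conj_conj,
      Complex.conj_eq_iff_im.2 (hw.real₁ x), Complex.conj_eq_iff_im.2 (hw.real₂ x)] at hx' ⊢
    linear_combination hx'
  · filter_upwards [tau_add_smul_add_smul (q := q) hz hw.sol₁.regular hw.sol₂.regular (conj c)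
      (conj d), hτz, hw.sol₁.eqn, hw.sol₂.eqn] with x hx h₀ h₁ h₂
    simp [hx, h₀, h₁, h₂]

end Weak

/-! ### The minimal operator and its extensions -/

section Adjoint

variable {𝕜 E F : Type*} [RCLike 𝕜] [NormedAddCommGroup E] [InnerProductSpace 𝕜 E]
  [NormedAddCommGroup F] [InnerProductSpace 𝕜 F]

theorem mem_orthogonal_comap_ofLp_iff (g : Submodule 𝕜 (E × F)) (v : WithLp 2 (E × F)) :
    v ∈ (g.comap (WithLp.linearEquiv 2 𝕜 (E × F)).toLinearMap)ᗮ ↔ (v.snd, -v.fst) ∈ g.adjoint := by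
  simp only [Submodule.mem_adjoint_iff, Submodule.mem_orthogonal, Submodule.mem_comap,
    WithLp.prod_inner_apply, inner_neg_right, sub_neg_eq_add, add_comm (inner 𝕜 _ v.snd)]
  exact ⟨fun h a b hab => h (WithLp.toLp 2 (a, b)) hab, fun h u hu => h u.fst u.snd hu⟩

theorem adjoint_adjoint_eq_topologicalClosure [CompleteSpace E] [CompleteSpace F]
    (g : Submodule 𝕜 (E × F)) : g.adjoint.adjoint = g.topologicalClosure := by
  set e := WithLp.prodContinuousLinearEquiv 2 𝕜 E F
  set K := g.comap (WithLp.linearEquiv 2 𝕜 (E × F)).toLinearMap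
  have hclosure : ∀ x, x ∈ g.topologicalClosure ↔ e.symm x ∈ K.topologicalClosure := fun x => by
    change _ ↔ e.symm x ∈ closure (e.toHomeomorph ⁻¹' (g : Set (E × F)))
    rw [← e.toHomeomorph.preimage_closure]
    rfl
  ext ⟨x, y⟩
  rw [hclosure, ← Submodule.orthogonal_orthogonal_eq_closure, Submodule.mem_orthogonal,
    Submodule.mem_adjoint_iff]
  constructor
  · intro h v hv
    have := h _ _ ((mem_orthogonal_comap_ofLp_iff g v).1 hv)
    rw [inner_neg_left, ← neg_add', neg_eq_zero] at this
    exact this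
  · intro h c d hcd
    have := h (WithLp.toLp 2 (-d, c)) ((mem_orthogonal_comap_ofLp_iff g _).2 (by simpa using hcd))
    rw [WithLp.prod_inner_apply] at this
    change inner 𝕜 (-d) x + inner 𝕜 c y = 0 at this
    rwa [inner_neg_left, neg_add_eq_zero, ← sub_eq_zero] at this

theorem closure_eq_adjoint_adjoint [CompleteSpace E] [CompleteSpace F] {S : E →ₗ.[𝕜] F}
    (hS : Dense (S.domain : Set E)) (hS' : Dense (S.adjoint.domain : Set F)) :
    S.closure = S.adjoint.adjoint := by
  have hgraph : S.adjoint.adjoint.graph = S.graph.topologicalClosure := by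
    rw [LinearPMap.adjoint_graph_eq_graph_adjoint hS',
      LinearPMap.adjoint_graph_eq_graph_adjoint hS, adjoint_adjoint_eq_topologicalClosure]
  have hclosable : S.IsClosable := ⟨_, hgraph.symm⟩
  exact LinearPMap.eq_of_eq_graph (hclosable.graph_closure_eq_closure_graph.symm.trans hgraph.symm)

end Adjoint

section Operators

variable {q : ℝ → ℝ} {T : L2 →ₗ.[ℂ] L2}

theorem ofInjective_symm_toL2 (y : maxFun q) (h : toL2 q y ∈ LinearMap.range (toL2 q)) :
    (LinearEquiv.ofInjective (toL2 q) (toL2_injective q)).symm ⟨toL2 q y, h⟩ = y :=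
  (LinearEquiv.symm_apply_eq _).2 rfl

theorem maxOp_apply (y : maxFun q) (h : toL2 q y ∈ (maxOp q).domain) :
    maxOp q ⟨toL2 q y, h⟩ = tauL2 q y :=
  congrArg (tauL2 q) (ofInjective_symm_toL2 y h)

theorem apply_toL2_eq_tauL2 (hT : T ≤ maxOp q) (y : maxFun q) (h : toL2 q y ∈ T.domain) :
    T ⟨toL2 q y, h⟩ = tauL2 q y :=
  (hT.2 rfl).trans (maxOp_apply y ⟨y, rfl⟩)

theorem le_maxOp_iff :
    T ≤ maxOp q ↔ ∀ g : T.domain, ∃ y : maxFun q, toL2 q y = g ∧ tauL2 q y = T g := by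
  constructor
  · rintro hT ⟨g, hg⟩
    obtain ⟨y, rfl⟩ := hT.1 hg
    exact ⟨y, rfl, (apply_toL2_eq_tauL2 hT y hg).symm⟩
  · intro H
    refine ⟨fun g hg => ?_, fun g f hgf => ?_⟩
    · obtain ⟨y, hy, -⟩ := H ⟨g, hg⟩
      exact ⟨y, hy⟩
    · obtain ⟨y, hy, hτ⟩ := H g
      obtain rfl : f = ⟨toL2 q y, y, rfl⟩ := Subtype.ext (hgf.symm.trans hy.symm)
      exact hτ.symm.trans (maxOp_apply y _).symm

theorem preMinDomain_le_domRestrict : preMinDomain q ≤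
    ((maxOp q).domRestrict (preMinDomain q)).domain := by
  rintro _ ⟨y, hy, rfl⟩
  exact ⟨⟨y, hy, rfl⟩, y, rfl⟩

theorem preMinDomain_le_maxOp_domain : preMinDomain q ≤ (maxOp q).domain :=
  preMinDomain_le_domRestrict.trans LinearPMap.domRestrict_le.1

theorem preMinDomain_le_minOp_domain : preMinDomain q ≤ (minOp q).domain :=
  preMinDomain_le_domRestrict.trans (LinearPMap.le_closure _).1

section Dense

variable {w₁ w₂ : ℝ → ℂ} (hw : IsFundamentalPair q w₁ w₂) (hT : T ≤ maxOp q)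
  (hS : preMinDomain q ≤ T.domain)

include hw

theorem IsFundamentalPair.dense_preMinDomain : Dense (preMinDomain q : Set L2) := by
  rw [Submodule.dense_iff_topologicalClosure_eq_top, Submodule.topologicalClosure_eq_top_iff,
    Submodule.eq_bot_iff]
  intro h hh
  obtain ⟨y, hy, rfl⟩ := hw.exists_of_inner_tauL2_eq (g := 0) (h := h) fun y hy => by
    rw [inner_zero_left]
    exact Submodule.inner_left_of_mem_orthogonal (K := preMinDomain q) ⟨y, hy, rfl⟩ hh
  obtain rfl : y = 0 := toL2_injective q (hy.trans (map_zero _).symm)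
  exact map_zero _

include hT hS

theorem IsFundamentalPair.adjoint_le_maxOp : T.adjoint ≤ maxOp q := by
  refine le_maxOp_iff.2 fun g => hw.exists_of_inner_tauL2_eq fun y hy => ?_
  have hy' : toL2 q y ∈ T.domain := hS ⟨y, hy, rfl⟩
  rw [← apply_toL2_eq_tauL2 hT y hy']
  exact LinearPMap.adjoint_isFormalAdjoint (hw.dense_preMinDomain.mono hS) g ⟨_, hy'⟩

end Dense

variable {w₁ w₂ : maxFun q}

theorem inner_tauL2_eq_inner_toL2_iff (hw : IsFundamentalPair q w₁ w₂) (f y : maxFun q) :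
    inner ℂ (tauL2 q y) (toL2 q f) = inner ℂ (toL2 q y) (tauL2 q f) ↔
      boundaryForm (boundary w₁ w₂ f).2 (boundary w₁ w₂ y).2 =
        boundaryForm (boundary w₁ w₂ f).1 (boundary w₁ w₂ y).1 := by
  rw [← hw.bvBot_eq, ← hw.bvTop_eq, ← sub_eq_zero (b := bvBot f y), ← inner_tauL2_sub_inner_toL2,
    sub_eq_zero, ← inner_conj_symm, ← inner_conj_symm (toL2 q y), (starRingEnd ℂ).injective.eq_iff,
    eq_comm]

theorem IsFundamentalPair.mem_adjoint_domain_iff (hw : IsFundamentalPair q w₁ w₂)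
    (hT : T ≤ maxOp q) (hS : preMinDomain q ≤ T.domain) {g : L2} :
    g ∈ T.adjoint.domain ↔ ∃ y : maxFun q, toL2 q y = g ∧ ∀ f : maxFun q, toL2 q f ∈ T.domain →
      boundaryForm (boundary w₁ w₂ f).2 (boundary w₁ w₂ y).2 =
        boundaryForm (boundary w₁ w₂ f).1 (boundary w₁ w₂ y).1 := by
  simp only [← inner_tauL2_eq_inner_toL2_iff hw]
  constructor
  · intro hg
    obtain ⟨y, rfl, hy⟩ := le_maxOp_iff.1 (hw.adjoint_le_maxOp hT hS) ⟨g, hg⟩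
    refine ⟨y, rfl, fun f hf => ?_⟩
    rw [hy, ← apply_toL2_eq_tauL2 hT f hf]
    exact LinearPMap.adjoint_isFormalAdjoint (hw.dense_preMinDomain.mono hS) ⟨_, hg⟩ ⟨_, hf⟩
  · rintro ⟨y, rfl, hy⟩
    refine LinearPMap.mem_adjoint_domain_of_exists _ ⟨tauL2 q y, ?_⟩
    rintro ⟨x, hx⟩
    obtain ⟨f, rfl⟩ := hT.1 hx
    rw [apply_toL2_eq_tauL2 hT f hx]
    exact hy f hx

theorem boundaryForm_zero_left (v : Fin 2 → ℂ) : boundaryForm 0 v = 0 := by simp [boundaryForm]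

theorem boundaryForm_zero_right (u : Fin 2 → ℂ) : boundaryForm u 0 = 0 := by simp [boundaryForm]

theorem boundaryForm_eq_iff {u v : Fin 2 → ℂ} :
    (∀ x, boundaryForm x u = boundaryForm x v) ↔ u = v := by
  refine ⟨fun h => ?_, fun h x => h ▸ rfl⟩
  have h₀ := h ![1, 0]
  have h₁ := h ![0, 1]
  simp only [boundaryForm, Matrix.cons_val_zero, Matrix.cons_val_one, map_one, map_zero, one_mul,
    zero_mul, sub_zero, zero_sub, neg_inj] at h₀ h₁
  exact funext (Fin.forall_fin_two.2 ⟨h₁, h₀⟩)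

section

variable (hw : IsFundamentalPair q w₁ w₂)

include hw

theorem IsFundamentalPair.adjoint_domRestrict_preMinDomain :
    ((maxOp q).domRestrict (preMinDomain q)).adjoint = maxOp q := by
  refine LinearPMap.eq_of_le_of_domain_eq
    (hw.adjoint_le_maxOp LinearPMap.domRestrict_le preMinDomain_le_domRestrict) ?_
  ext g
  rw [hw.mem_adjoint_domain_iff LinearPMap.domRestrict_le preMinDomain_le_domRestrict]
  refine exists_congr fun y => and_iff_left ?_
  rintro f ⟨⟨z, hz, hzf⟩, -⟩
  obtain rfl := toL2_injective q hzf
  rw [boundary_eq_zero_of_hasCompactSupport hz, Prod.snd_zero, Prod.fst_zero,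
    boundaryForm_zero_left, boundaryForm_zero_left]

theorem IsFundamentalPair.minOp_eq_adjoint_maxOp : minOp q = (maxOp q).adjoint := by
  rw [minOp, closure_eq_adjoint_adjoint (hw.dense_preMinDomain.mono preMinDomain_le_domRestrict)]
  all_goals rw [hw.adjoint_domRestrict_preMinDomain]
  exact hw.dense_preMinDomain.mono preMinDomain_le_maxOp_domain

theorem IsFundamentalPair.minOp_le_maxOp : minOp q ≤ maxOp q := by
  rw [hw.minOp_eq_adjoint_maxOp]
  exact hw.adjoint_le_maxOp le_rfl preMinDomain_le_maxOp_domain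

theorem IsFundamentalPair.mem_minOp_domain_iff {y : maxFun q} :
    toL2 q y ∈ (minOp q).domain ↔ boundary w₁ w₂ y = 0 := by
  rw [hw.minOp_eq_adjoint_maxOp,
    hw.mem_adjoint_domain_iff le_rfl preMinDomain_le_maxOp_domain]
  constructor
  · rintro ⟨z, hz, h⟩
    obtain rfl := toL2_injective q hz
    have hform : ∀ a b, boundaryForm b (boundary w₁ w₂ z).2 =
        boundaryForm a (boundary w₁ w₂ z).1 := fun a b => by
      obtain ⟨f, hf⟩ := hw.boundary_surjective (a, b)
      simpa only [hf] using h f ⟨f, rfl⟩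
    refine Prod.ext (boundaryForm_eq_iff.1 fun a => ?_) (boundaryForm_eq_iff.1 fun b => ?_)
    · rw [← hform a 0, boundaryForm_zero_left, Prod.fst_zero, boundaryForm_zero_right]
    · rw [hform 0 b, boundaryForm_zero_left, Prod.snd_zero, boundaryForm_zero_right]
  · intro hy
    refine ⟨y, rfl, fun f _ => ?_⟩
    rw [hy, Prod.snd_zero, Prod.fst_zero, boundaryForm_zero_right, boundaryForm_zero_right]

theorem IsBiExtension.le_maxOp (hT : IsBiExtension (minOp q) T) : T ≤ maxOp q :=
  hT.le_adjoint.trans (hw.adjoint_le_maxOp hw.minOp_le_maxOp preMinDomain_le_minOp_domain)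

end

/-- The boundary values on the domain of a restriction `T` of the maximal operator. -/
def boundaryOn (w₁ w₂ : maxFun q) (hT : T ≤ maxOp q) :
    T.domain →ₗ[ℂ] (Fin 2 → ℂ) × (Fin 2 → ℂ) :=
  boundary w₁ w₂ ∘ₗ (LinearEquiv.ofInjective (toL2 q) (toL2_injective q)).symm.toLinearMap ∘ₗ
    Submodule.inclusion hT.1

theorem boundaryOn_toL2 (hT : T ≤ maxOp q) (y : maxFun q) (h : toL2 q y ∈ T.domain) :
    boundaryOn w₁ w₂ hT ⟨toL2 q y, h⟩ = boundary w₁ w₂ y :=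
  congrArg (boundary w₁ w₂) (ofInjective_symm_toL2 y (hT.1 h))

section

variable (hw : IsFundamentalPair q w₁ w₂)

include hw

theorem ker_boundaryOn (hT : T ≤ maxOp q) :
    LinearMap.ker (boundaryOn w₁ w₂ hT) = (minOp q).domain.submoduleOf T.domain := by
  ext ⟨x, hx⟩
  obtain ⟨y, rfl⟩ := hT.1 hx
  rw [LinearMap.mem_ker, boundaryOn_toL2, ← hw.mem_minOp_domain_iff]
  rfl

theorem mem_domain_iff_boundary_mem_range (hT : T ≤ maxOp q) (hmin : minOp q ≤ T) (y : maxFun q) :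
    toL2 q y ∈ T.domain ↔ boundary w₁ w₂ y ∈ LinearMap.range (boundaryOn w₁ w₂ hT) := by
  constructor
  · exact fun hy => ⟨⟨_, hy⟩, boundaryOn_toL2 hT y hy⟩
  · rintro ⟨⟨x, hx⟩, h⟩
    obtain ⟨z, rfl⟩ := hT.1 hx
    rw [boundaryOn_toL2] at h
    have hyz : toL2 q (y - z) ∈ (minOp q).domain := by
      rw [hw.mem_minOp_domain_iff, map_sub, h, sub_self]
    simpa using T.domain.add_mem (hmin.1 hyz) hx

theorem IsTwoDimBiExtension.exists_submodule (hT : IsTwoDimBiExtension (minOp q) T) :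
    ∃ V : Submodule ℂ ((Fin 2 → ℂ) × (Fin 2 → ℂ)), Module.finrank ℂ V = 2 ∧
      (T.domain : Set L2) = bcDomain q w₁ w₂ fun a b => (a, b) ∈ V := by
  have hle : T ≤ maxOp q := hT.toIsBiExtension.le_maxOp hw
  refine ⟨LinearMap.range (boundaryOn w₁ w₂ hle), ?_, ?_⟩
  · rw [← (boundaryOn w₁ w₂ hle).quotKerEquivRange.finrank_eq, ker_boundaryOn hw]
    exact hT.finrank_eq
  · ext g
    constructor
    · intro hg
      obtain ⟨y, rfl⟩ := hle.1 hg
      exact ⟨y, rfl, (mem_domain_iff_boundary_mem_range hw hle hT.le y).1 hg⟩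
    · rintro ⟨y, rfl, hy⟩
      exact (mem_domain_iff_boundary_mem_range hw hle hT.le y).2 hy

end

end Operators

/-! ### Boundary conditions -/

section BoundaryConditions

variable {q : ℝ → ℝ} {T : L2 →ₗ.[ℂ] L2} {C : (Fin 2 → ℂ) → (Fin 2 → ℂ) → Prop}

theorem toL2_mem_bcDomain_iff {w₁ w₂ : maxFun q} {y : maxFun q} :
    toL2 q y ∈ bcDomain q w₁ w₂ C ↔ C (boundary w₁ w₂ y).1 (boundary w₁ w₂ y).2 := by
  constructor
  · rintro ⟨z, hz, hC⟩
    rwa [toL2_injective q hz] at hC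
  · exact fun hC => ⟨y, rfl, hC⟩

theorem bcDomain_congr {w₁ w₂ : ℝ → ℂ} {C' : (Fin 2 → ℂ) → (Fin 2 → ℂ) → Prop}
    (h : ∀ a b, C a b ↔ C' a b) : bcDomain q w₁ w₂ C = bcDomain q w₁ w₂ C' := by
  simp only [bcDomain, h]

theorem IsFundamentalPair.adjoint_domain_eq_bcDomain {w₁ w₂ : maxFun q}
    (hw : IsFundamentalPair q w₁ w₂) (hT : T ≤ maxOp q) (h₀ : C 0 0)
    (hC : (T.domain : Set L2) = bcDomain q w₁ w₂ C) :
    (T.adjoint.domain : Set L2) = bcDomain q w₁ w₂ fun a b =>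
      ∀ u v, C u v → boundaryForm v b = boundaryForm u a := by
  have hmem : ∀ y, toL2 q y ∈ T.domain ↔ C (boundary w₁ w₂ y).1 (boundary w₁ w₂ y).2 := fun y => by
    rw [← SetLike.mem_coe, hC, toL2_mem_bcDomain_iff]
  have hS : preMinDomain q ≤ T.domain := by
    rintro _ ⟨y, hy, rfl⟩
    rwa [hmem, boundary_eq_zero_of_hasCompactSupport hy]
  ext g
  rw [SetLike.mem_coe, hw.mem_adjoint_domain_iff hT hS]
  refine exists_congr fun y => and_congr_right fun _ => ⟨fun H u v huv => ?_, fun H f hf => ?_⟩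
  · obtain ⟨f, hf⟩ := hw.boundary_surjective (u, v)
    have h := H f ((hmem f).2 (by rwa [hf]))
    rwa [hf] at h
  · exact H _ _ ((hmem f).1 hf)

end BoundaryConditions

/-! ### Parity -/

section Parity

variable {q : ℝ → ℝ} (hq : ∀ x, q x = q (-x))

theorem parity_parity (f : L2) : parity (parity f) = f := by
  have hneg := Measure.measurePreserving_neg (volume : Measure ℝ)
  refine (Lp.compMeasurePreserving_comp_apply f hneg hneg).symm.trans (Lp.ext ?_)
  refine (Lp.coeFn_compMeasurePreserving _ _).trans (ae_of_all _ fun x => ?_)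
  simp

theorem kreinAdjoint_domain (T : L2 →ₗ.[ℂ] L2) :
    (kreinAdjoint T).domain = T.adjoint.domain.map parity := by
  ext g
  rw [Submodule.mem_map]
  constructor
  · exact fun h => ⟨_, h, parity_parity g⟩
  · rintro ⟨f, hf, rfl⟩
    change parity (parity f) ∈ T.adjoint.domain
    rwa [parity_parity]

include hq in
theorem tau_comp_neg {y : ℝ → ℂ} : tau q (fun x => y (-x)) = tau q y ∘ Neg.neg := by
  have hderiv : deriv (fun x => y (-x)) = fun x => -deriv y (-x) := funext (deriv_comp_neg y)
  ext x
  rw [tau, hderiv, deriv.fun_neg, deriv_comp_neg, Function.comp_apply, tau, ← hq, neg_neg]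

/-- The reflection `x ↦ y (-x)` on the maximal domain of an even potential; on classes in `L²(ℝ)`
it is `parity`. -/
def reflection (y : maxFun q) : maxFun q :=
  ⟨fun x => (y : ℝ → ℂ) (-x), y.2.1.comp_neg,
    y.2.2.1.comp_measurePreserving (Measure.measurePreserving_neg volume), by
      rw [tau_comp_neg hq]
      exact y.2.2.2.comp_measurePreserving (Measure.measurePreserving_neg volume)⟩

theorem parity_toL2 (y : maxFun q) : parity (toL2 q y) = toL2 q (reflection hq y) :=
  Lp.toLp_compMeasurePreserving y.2.2.1 (Measure.measurePreserving_neg volume)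

theorem bracket_comp_neg_of_odd {w : ℝ → ℂ} (hw : ∀ x, w (-x) = -w x) (y : ℝ → ℂ) (x : ℝ) :
    bracket w (fun t => y (-t)) x = bracket w y (-x) := by
  have h := bracket_comp_neg w y x
  rwa [show (fun t => w (-t)) = -w from funext hw, bracket_neg_left, Pi.neg_apply, neg_inj] at h

theorem bracket_comp_neg_of_even {w : ℝ → ℂ} (hw : ∀ x, w (-x) = w x) (y : ℝ → ℂ) (x : ℝ) :
    bracket w (fun t => y (-t)) x = -bracket w y (-x) := by
  have h := bracket_comp_neg w y x
  rwa [show (fun t => w (-t)) = w from funext hw] at h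

/-- The reflection `(v₁, v₂) ↦ (v₁, -v₂)` of `ℂ²`: besides exchanging `±∞`, parity acts in this way
on boundary values, since `w₁` is odd and `w₂` is even. -/
def reflect (v : Fin 2 → ℂ) : Fin 2 → ℂ := ![v 0, -v 1]

theorem reflect_reflect (v : Fin 2 → ℂ) : reflect (reflect v) = v :=
  funext (Fin.forall_fin_two.2 ⟨rfl, neg_neg (v 1)⟩)

variable {w₁ w₂ : maxFun q}

theorem boundary_reflection (hw : IsReferencePair q w₁ w₂) (y : maxFun q) :
    boundary w₁ w₂ (reflection hq y) =
      (reflect (boundary w₁ w₂ y).2, reflect (boundary w₁ w₂ y).1) := by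
  have hodd := bracket_comp_neg_of_odd hw.odd₁ y
  have heven := bracket_comp_neg_of_even hw.even₂ y
  have hα₁ : bvBot w₁ (reflection hq y) = bvTop w₁ y :=
    tendsto_nhds_unique (tendsto_bvBot w₁ _)
      (((tendsto_bvTop w₁ y).comp tendsto_neg_atBot_atTop).congr fun x => (hodd x).symm)
  have hα₂ : bvBot w₂ (reflection hq y) = -bvTop w₂ y :=
    tendsto_nhds_unique (tendsto_bvBot w₂ _)
      (((tendsto_bvTop w₂ y).comp tendsto_neg_atBot_atTop).neg.congr fun x => (heven x).symm)
  have hβ₁ : bvTop w₁ (reflection hq y) = bvBot w₁ y :=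
    tendsto_nhds_unique (tendsto_bvTop w₁ _)
      (((tendsto_bvBot w₁ y).comp tendsto_neg_atTop_atBot).congr fun x => (hodd x).symm)
  have hβ₂ : bvTop w₂ (reflection hq y) = -bvBot w₂ y :=
    tendsto_nhds_unique (tendsto_bvTop w₂ _)
      (((tendsto_bvBot w₂ y).comp tendsto_neg_atTop_atBot).neg.congr fun x => (heven x).symm)
  simp only [boundary, LinearMap.coe_mk, AddHom.coe_mk, hα₁, hα₂, hβ₁, hβ₂, reflect,
    Matrix.cons_val_zero, Matrix.cons_val_one]

include hq in
theorem parity_mem_bcDomain_iff (hw : IsReferencePair q w₁ w₂)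
    {C : (Fin 2 → ℂ) → (Fin 2 → ℂ) → Prop} {g : L2} :
    parity g ∈ bcDomain q w₁ w₂ C ↔
      g ∈ bcDomain q w₁ w₂ fun a b => C (reflect b) (reflect a) := by
  constructor
  · rintro ⟨y, hy, hC⟩
    rw [← parity_parity g, ← hy, parity_toL2 hq, toL2_mem_bcDomain_iff, boundary_reflection hq hw]
    simp only [reflect_reflect]
    exact hC
  · rintro ⟨y, rfl, hC⟩
    rw [parity_toL2 hq, toL2_mem_bcDomain_iff, boundary_reflection hq hw]
    exact hC

include hq in
theorem kreinAdjoint_domain_eq_bcDomain (hw : IsReferencePair q w₁ w₂) {T : L2 →ₗ.[ℂ] L2}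
    {C : (Fin 2 → ℂ) → (Fin 2 → ℂ) → Prop}
    (hC : (T.adjoint.domain : Set L2) = bcDomain q w₁ w₂ C) :
    ((kreinAdjoint T).domain : Set L2) =
      bcDomain q w₁ w₂ fun a b => C (reflect b) (reflect a) := by
  ext g
  rw [← parity_mem_bcDomain_iff hq hw, ← hC]
  rfl

end Parity

/-! ### Planes of boundary values -/

section Planes

variable {K E F : Type*} [Field K] [AddCommGroup E] [Module K E] [FiniteDimensional K E]
  [AddCommGroup F] [Module K F] [FiniteDimensional K F]

theorem exists_eq_graph_of_finrank_eq {V : Submodule K (E × F)}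
    (hV : Module.finrank K V = Module.finrank K E) (hinj : ∀ x ∈ V, x.1 = 0 → x = 0) :
    ∃ f : E →ₗ[K] F, V = f.graph := by
  have hinj' : Function.Injective ((LinearMap.fst K E F).domRestrict V) := by
    rw [← LinearMap.ker_eq_bot, Submodule.eq_bot_iff]
    exact fun x hx => Subtype.ext (hinj x x.2 hx)
  exact Submodule.exists_eq_graph
    ⟨hinj', (LinearMap.injective_iff_surjective_of_finrank_eq_finrank hV).1 hinj'⟩

theorem finrank_prod_submodule (p : Submodule K E) (r : Submodule K F) :
    Module.finrank K (p.prod r) = Module.finrank K p + Module.finrank K r := by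
  have hrange : p.prod r = LinearMap.range (p.subtype.prodMap r.subtype) := by
    rw [LinearMap.range_prodMap, Submodule.range_subtype, Submodule.range_subtype]
  rw [hrange, LinearMap.finrank_range_of_inj, Module.finrank_prod]
  exact p.subtype_injective.prodMap r.subtype_injective

theorem eq_prod_span_of_finrank_eq_two {V : Submodule K (E × F)} (hV : Module.finrank K V = 2)
    {u : E} {v : F} (hu : u ≠ 0) (hv : v ≠ 0) (huV : (u, 0) ∈ V) (hvV : (0, v) ∈ V) :
    V = (Submodule.span K {u}).prod (Submodule.span K {v}) := by
  refine (Submodule.eq_of_le_of_finrank_eq ?_ ?_).symm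
  · rintro ⟨x, y⟩ ⟨hx, hy⟩
    obtain ⟨c, rfl⟩ := Submodule.mem_span_singleton.1 hx
    obtain ⟨d, rfl⟩ := Submodule.mem_span_singleton.1 hy
    simpa using V.add_mem (V.smul_mem c huV) (V.smul_mem d hvV)
  · rw [hV, finrank_prod_submodule, finrank_span_singleton hu, finrank_span_singleton hv]

theorem eq_prod_span_or_eq_graph {V : Submodule K (E × F)} (hV : Module.finrank K V = 2)
    (hE : Module.finrank K E = 2) (hF : Module.finrank K F = 2) :
    (∃ u v, u ≠ 0 ∧ v ≠ 0 ∧ V = (Submodule.span K {u}).prod (Submodule.span K {v})) ∨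
      (∃ f : E →ₗ[K] F, ∀ x y, (x, y) ∈ V ↔ y = f x) ∨
      ∃ f : F →ₗ[K] E, ∀ x y, (x, y) ∈ V ↔ x = f y := by
  by_cases hfst : ∀ x ∈ V, x.1 = 0 → x = 0
  · obtain ⟨f, rfl⟩ := exists_eq_graph_of_finrank_eq (hV.trans hE.symm) hfst
    exact Or.inr (Or.inl ⟨f, fun x y => LinearMap.mem_graph_iff f (x, y)⟩)
  by_cases hsnd : ∀ x ∈ V, x.2 = 0 → x = 0
  · obtain ⟨f, hf⟩ := exists_eq_graph_of_finrank_eq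
      (V := V.map (LinearEquiv.prodComm K E F).toLinearMap)
      ((LinearEquiv.finrank_map_eq _ V).trans (hV.trans hF.symm)) (by
        rintro _ ⟨x, hx, rfl⟩ h
        rw [hsnd x hx h, map_zero])
    refine Or.inr (Or.inr ⟨f, fun x y => ?_⟩)
    have hgraph := SetLike.ext_iff.1 hf (y, x)
    rwa [LinearMap.mem_graph_iff, Submodule.mem_map_equiv] at hgraph
  · push Not at hfst hsnd
    obtain ⟨⟨_, v⟩, hvV, rfl, hv⟩ := hfst
    obtain ⟨⟨u, _⟩, huV, rfl, hu⟩ := hsnd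
    have hu₀ : u ≠ 0 := fun h => hu (by rw [h]; rfl)
    have hv₀ : v ≠ 0 := fun h => hv (by rw [h]; rfl)
    exact Or.inl ⟨u, v, hu₀, hv₀, eq_prod_span_of_finrank_eq_two hV hu₀ hv₀ huV hvV⟩

end Planes

section Separated

/-- The direction `(sin θ, ξ cos θ)` of the line `v₁ ξ cos θ - v₂ sin θ = 0` in `ℂ²`, where
`|ξ| = 1`. -/
def separatedVector (ξ : ℂ) (θ : ℝ) : Fin 2 → ℂ := ![Real.sin θ, ξ * Real.cos θ]

variable {ξ : ℂ} {θ : ℝ}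

theorem mul_conj_of_norm_eq_one (hξ : ‖ξ‖ = 1) : ξ * conj ξ = 1 := by
  rw [Complex.mul_conj', hξ, Complex.ofReal_one, one_pow]

theorem mem_span_separatedVector_iff (hξ : ‖ξ‖ = 1) {a : Fin 2 → ℂ} :
    a ∈ Submodule.span ℂ {separatedVector ξ θ} ↔
      ξ * Real.cos θ * a 0 + -(Real.sin θ : ℂ) * a 1 = 0 := by
  have hsq : (Real.sin θ : ℂ) ^ 2 + (Real.cos θ : ℂ) ^ 2 = 1 := by
    exact_mod_cast Real.sin_sq_add_cos_sq θ
  rw [Submodule.mem_span_singleton]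
  constructor
  · rintro ⟨c, rfl⟩
    simp only [separatedVector, Pi.smul_apply, Matrix.cons_val_zero, Matrix.cons_val_one,
      smul_eq_mul]
    ring
  · intro h
    refine ⟨Real.sin θ * a 0 + conj ξ * Real.cos θ * a 1, funext (Fin.forall_fin_two.2 ⟨?_, ?_⟩)⟩
    · simp only [separatedVector, Pi.smul_apply, Matrix.cons_val_zero, smul_eq_mul]
      linear_combination a 0 * hsq - conj ξ * Real.cos θ * h +
        Real.cos θ ^ 2 * a 0 * mul_conj_of_norm_eq_one hξ
    · simp only [separatedVector, Pi.smul_apply, Matrix.cons_val_one, Matrix.cons_val_fin_one,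
        smul_eq_mul]
      linear_combination a 1 * hsq + Real.sin θ * h +
        Real.cos θ ^ 2 * a 1 * mul_conj_of_norm_eq_one hξ

theorem exists_eq_mul_sin_cos {x y : ℝ} (hx : 0 ≤ x) :
    ∃ r : ℝ, ∃ θ ∈ Set.Ico 0 (2 * Real.pi), x = r * Real.sin θ ∧ y = r * Real.cos θ := by
  refine ⟨‖(⟨y, x⟩ : ℂ)‖, Complex.arg ⟨y, x⟩, ⟨Complex.arg_nonneg_iff.2 hx, ?_⟩,
    (Complex.norm_mul_sin_arg ⟨y, x⟩).symm, (Complex.norm_mul_cos_arg ⟨y, x⟩).symm⟩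
  linarith [Complex.arg_le_pi ⟨y, x⟩, Real.pi_pos]

theorem exists_span_eq_span_separatedVector {u : Fin 2 → ℂ} (hu : u ≠ 0) :
    ∃ ξ : ℂ, ‖ξ‖ = 1 ∧ ∃ θ ∈ Set.Ico 0 (2 * Real.pi),
      Submodule.span ℂ {u} = Submodule.span ℂ {separatedVector ξ θ} := by
  obtain ⟨r, θ, hθ, hsin, hcos⟩ := exists_eq_mul_sin_cos (y := ‖u 1‖) (norm_nonneg (u 0))
  set φ := Complex.arg (u 0)
  set ψ := Complex.arg (u 1)
  set c : ℂ := r * Complex.exp (φ * Complex.I)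
  have hpolar : u = c • separatedVector (Complex.exp ((ψ - φ : ℝ) * Complex.I)) θ := by
    refine funext (Fin.forall_fin_two.2 ⟨?_, ?_⟩)
    · rw [← Complex.norm_mul_exp_arg_mul_I (u 0), hsin]
      simp only [separatedVector, c, Pi.smul_apply, Matrix.cons_val_zero, smul_eq_mul,
        Complex.ofReal_mul]
      ring
    · have hexp : Complex.exp (ψ * Complex.I) =
          Complex.exp (φ * Complex.I) * Complex.exp ((ψ - φ : ℝ) * Complex.I) := by
        rw [← Complex.exp_add, Complex.ofReal_sub]
        ring_nf
      rw [← Complex.norm_mul_exp_arg_mul_I (u 1), hcos, hexp]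
      simp only [separatedVector, c, Pi.smul_apply, Matrix.cons_val_one, Matrix.cons_val_fin_one,
        smul_eq_mul, Complex.ofReal_mul]
      ring
  have hc : c ≠ 0 := fun hc => hu (by rw [hpolar, hc, zero_smul])
  refine ⟨_, Complex.norm_exp_ofReal_mul_I (ψ - φ), θ, hθ, ?_⟩
  rw [hpolar, Submodule.span_singleton_smul_eq hc.isUnit]

theorem boundaryForm_smul_left (c : ℂ) (u v : Fin 2 → ℂ) :
    boundaryForm (c • u) v = conj c * boundaryForm u v := by
  simp only [boundaryForm, Pi.smul_apply, smul_eq_mul, map_mul]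
  ring

theorem boundaryForm_separatedVector_eq_zero_iff (hξ : ‖ξ‖ = 1) {v : Fin 2 → ℂ} :
    boundaryForm (separatedVector ξ θ) v = 0 ↔
      (Real.cos θ : ℂ) * v 0 + -(ξ * Real.sin θ) * v 1 = 0 := by
  have hξ₀ : ξ ≠ 0 := norm_ne_zero_iff.1 (hξ ▸ one_ne_zero)
  have hmul : (Real.cos θ : ℂ) * v 0 + -(ξ * Real.sin θ) * v 1 =
      -ξ * boundaryForm (separatedVector ξ θ) v := by
    simp only [boundaryForm, separatedVector, Matrix.cons_val_zero, Matrix.cons_val_one, map_mul,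
      Complex.conj_ofReal]
    linear_combination -(Real.cos θ : ℂ) * v 0 * mul_conj_of_norm_eq_one hξ
  rw [hmul, mul_eq_zero, or_iff_right (neg_ne_zero.2 hξ₀)]

theorem forall_separated_boundaryForm_eq_zero_iff (hξ : ‖ξ‖ = 1) {v : Fin 2 → ℂ} :
    (∀ u : Fin 2 → ℂ, ξ * Real.cos θ * u 0 + -(Real.sin θ : ℂ) * u 1 = 0 →
      boundaryForm u v = 0) ↔ (Real.cos θ : ℂ) * v 0 + -(ξ * Real.sin θ) * v 1 = 0 := by
  simp only [← mem_span_separatedVector_iff hξ, ← boundaryForm_separatedVector_eq_zero_iff hξ]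
  refine ⟨fun h => h _ (Submodule.mem_span_singleton_self _), fun h u hu => ?_⟩
  obtain ⟨c, rfl⟩ := Submodule.mem_span_singleton.1 hu
  rw [boundaryForm_smul_left, h, mul_zero]

end Separated

section Mixed

theorem boundaryForm_mulVec_left (a b c d : ℂ) (x v : Fin 2 → ℂ) :
    boundaryForm ((!![a, b; c, d]).mulVec x) v =
      boundaryForm x ((!![conj d, -conj b; -conj c, conj a]).mulVec v) := by
  simp only [boundaryForm, Matrix.mulVec, dotProduct, Fin.sum_univ_two, Matrix.of_apply,
    Matrix.cons_val', Matrix.cons_val_zero, Matrix.cons_val_one, Matrix.cons_val_fin_one, map_add,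
    map_mul]
  ring

theorem reflect_eq_mulVec_reflect_iff (a b c d : ℂ) (u v : Fin 2 → ℂ) :
    reflect u = (!![a, -b; -c, d]).mulVec (reflect v) ↔ u = (!![a, b; c, d]).mulVec v := by
  have hmulVec : (!![a, -b; -c, d]).mulVec (reflect v) =
      reflect ((!![a, b; c, d]).mulVec v) := by
    refine funext (Fin.forall_fin_two.2 ⟨?_, ?_⟩) <;>
    · simp only [reflect, Matrix.mulVec, dotProduct, Fin.sum_univ_two, Matrix.of_apply,
        Matrix.cons_val', Matrix.cons_val_zero, Matrix.cons_val_one, Matrix.cons_val_fin_one]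
      ring
  rw [hmulVec, (Function.LeftInverse.injective reflect_reflect).eq_iff]

end Mixed

/-! ### Classification and adjoints -/

section Classification

variable {q : ℝ → ℝ} {w₁ w₂ : maxFun q} {T : L2 →ₗ.[ℂ] L2}

theorem IsTwoDimBiExtension.domain_cases (hw : IsFundamentalPair q w₁ w₂)
    (hT : IsTwoDimBiExtension (minOp q) T) :
    (∃ (ξ η : ℂ) (a b : ℝ), ‖ξ‖ = 1 ∧ ‖η‖ = 1 ∧
      a ∈ Set.Ico 0 (2 * Real.pi) ∧ b ∈ Set.Ico 0 (2 * Real.pi) ∧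
      (T.domain : Set L2) = normalizedSeparatedDomain q w₁ w₂ ξ η a b) ∨
    (∃ M, (T.domain : Set L2) = betaOfAlphaDomain q w₁ w₂ M) ∨
    ∃ M, (T.domain : Set L2) = alphaOfBetaDomain q w₁ w₂ M := by
  obtain ⟨V, hV, hdom⟩ := hT.exists_submodule hw
  rw [hdom]
  rcases eq_prod_span_or_eq_graph hV (Module.finrank_fin_fun ℂ) (Module.finrank_fin_fun ℂ) with
    ⟨u, v, hu, hv, rfl⟩ | ⟨f, hf⟩ | ⟨f, hf⟩
  · obtain ⟨ξ, hξ, a, ha, hua⟩ := exists_span_eq_span_separatedVector hu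
    obtain ⟨η, hη, b, hb, hvb⟩ := exists_span_eq_span_separatedVector hv
    refine Or.inl ⟨ξ, η, a, b, hξ, hη, ha, hb, ?_⟩
    rw [normalizedSeparatedDomain, separatedDomain]
    refine bcDomain_congr fun x y => ?_
    rw [Submodule.mem_prod, hua, hvb, mem_span_separatedVector_iff hξ,
      mem_span_separatedVector_iff hη]
  · refine Or.inr (Or.inl ⟨LinearMap.toMatrix' f, bcDomain_congr fun x y => ?_⟩)
    rw [hf, LinearMap.toMatrix'_mulVec]
  · refine Or.inr (Or.inr ⟨LinearMap.toMatrix' f, bcDomain_congr fun x y => ?_⟩)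
    rw [hf, LinearMap.toMatrix'_mulVec]

end Classification

section Adjoints

variable {q : ℝ → ℝ} {w₁ w₂ : maxFun q} {T : L2 →ₗ.[ℂ] L2}

theorem forall_and_boundaryForm_eq_iff {P Q : (Fin 2 → ℂ) → Prop} (hP : P 0) (hQ : Q 0)
    {x y : Fin 2 → ℂ} :
    (∀ u v, P u ∧ Q v → boundaryForm v y = boundaryForm u x) ↔
      (∀ u, P u → boundaryForm u x = 0) ∧ ∀ v, Q v → boundaryForm v y = 0 := by
  refine ⟨fun h => ⟨fun u hu => ?_, fun v hv => ?_⟩, fun h u v huv => ?_⟩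
  · rw [← h u 0 ⟨hu, hQ⟩, boundaryForm_zero_left]
  · rw [h 0 v ⟨hP, hv⟩, boundaryForm_zero_left]
  · rw [h.1 u huv.1, h.2 v huv.2]

section

variable (hw : IsFundamentalPair q w₁ w₂) (hT : T ≤ maxOp q)

include hw hT

theorem adjoint_domain_of_normalizedSeparatedDomain {ξ η : ℂ} {a b : ℝ} (hξ : ‖ξ‖ = 1)
    (hη : ‖η‖ = 1)
    (hdom : (T.domain : Set L2) = normalizedSeparatedDomain q w₁ w₂ ξ η a b) :
    (T.adjoint.domain : Set L2) = separatedDomain q w₁ w₂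
      (Real.cos a) (-(ξ * Real.sin a)) (Real.cos b) (-(η * Real.sin b)) := by
  rw [normalizedSeparatedDomain, separatedDomain] at hdom
  refine (hw.adjoint_domain_eq_bcDomain hT (by simp) hdom).trans (bcDomain_congr fun x y => ?_)
  rw [forall_and_boundaryForm_eq_iff (by simp) (by simp),
    forall_separated_boundaryForm_eq_zero_iff hξ, forall_separated_boundaryForm_eq_zero_iff hη]

theorem adjoint_domain_of_betaOfAlphaDomain {a b c d : ℂ}
    (hdom : (T.domain : Set L2) = betaOfAlphaDomain q w₁ w₂ !![a, b; c, d]) :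
    (T.adjoint.domain : Set L2) =
      alphaOfBetaDomain q w₁ w₂ !![conj d, -conj b; -conj c, conj a] := by
  refine (hw.adjoint_domain_eq_bcDomain hT (Matrix.mulVec_zero _).symm hdom).trans
    (bcDomain_congr fun x y => ?_)
  simp only [forall_eq, boundaryForm_mulVec_left, boundaryForm_eq_iff]
  exact eq_comm

theorem adjoint_domain_of_alphaOfBetaDomain {a b c d : ℂ}
    (hdom : (T.domain : Set L2) = alphaOfBetaDomain q w₁ w₂ !![a, b; c, d]) :
    (T.adjoint.domain : Set L2) =
      betaOfAlphaDomain q w₁ w₂ !![conj d, -conj b; -conj c, conj a] := by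
  refine (hw.adjoint_domain_eq_bcDomain hT (Matrix.mulVec_zero _).symm hdom).trans
    (bcDomain_congr fun x y => ?_)
  rw [forall_comm]
  simp only [forall_eq, boundaryForm_mulVec_left, boundaryForm_eq_iff]

end

section

variable (hq : ∀ x, q x = q (-x)) (hw : IsReferencePair q w₁ w₂)

include hq hw

theorem kreinAdjoint_domain_of_separatedDomain {a b c d : ℂ}
    (hdom : (T.adjoint.domain : Set L2) = separatedDomain q w₁ w₂ a (-b) c (-d)) :
    ((kreinAdjoint T).domain : Set L2) = separatedDomain q w₁ w₂ c d a b := by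
  refine (kreinAdjoint_domain_eq_bcDomain hq hw hdom).trans (bcDomain_congr fun x y => ?_)
  simp only [reflect, Matrix.cons_val_zero, Matrix.cons_val_one, Matrix.cons_val_fin_one,
    neg_mul_neg]
  exact and_comm

theorem kreinAdjoint_domain_of_alphaOfBetaDomain {a b c d : ℂ}
    (hdom : (T.adjoint.domain : Set L2) = alphaOfBetaDomain q w₁ w₂ !![a, -b; -c, d]) :
    ((kreinAdjoint T).domain : Set L2) = betaOfAlphaDomain q w₁ w₂ !![a, b; c, d] :=
  (kreinAdjoint_domain_eq_bcDomain hq hw hdom).trans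
    (bcDomain_congr fun x y => reflect_eq_mulVec_reflect_iff a b c d y x)

theorem kreinAdjoint_domain_of_betaOfAlphaDomain {a b c d : ℂ}
    (hdom : (T.adjoint.domain : Set L2) = betaOfAlphaDomain q w₁ w₂ !![a, -b; -c, d]) :
    ((kreinAdjoint T).domain : Set L2) = alphaOfBetaDomain q w₁ w₂ !![a, b; c, d] :=
  (kreinAdjoint_domain_eq_bcDomain hq hw hdom).trans
    (bcDomain_congr fun x y => reflect_eq_mulVec_reflect_iff a b c d x y)

end

end Adjoints

end LimitCircle

end

open LimitCircle in
theorem mainTheorem8 (q : ℝ → ℝ) (hq : LocallyIntegrable q volume)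
    (hq_even : ∀ x, q x = q (-x))
    (hTop : IsLimitCircleTop q) (hBot : IsLimitCircleBot q)
    (w₁ w₂ : ℝ → ℂ) (hw : IsReferencePair q w₁ w₂) :
    -- every two-dimensional bi-extension is of one of the three types treated below
    (∀ T : L2 →ₗ.[ℂ] L2, IsTwoDimBiExtension (minOp q) T →
      (∃ (ξ η : ℂ) (a b : ℝ), ‖ξ‖ = 1 ∧ ‖η‖ = 1 ∧
        a ∈ Set.Ico 0 (2 * Real.pi) ∧ b ∈ Set.Ico 0 (2 * Real.pi) ∧
        (T.domain : Set L2) = normalizedSeparatedDomain q w₁ w₂ ξ η a b) ∨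
      (∃ a b c d : ℂ, (T.domain : Set L2) = betaOfAlphaDomain q w₁ w₂ !![a, b; c, d]) ∨
      (∃ a b c d : ℂ, (T.domain : Set L2) = alphaOfBetaDomain q w₁ w₂ !![a, b; c, d])) ∧
    -- the domain of the Krein space adjoint is the reflection of the domain of the adjoint
    (∀ T : L2 →ₗ.[ℂ] L2, T ≤ maxOp q →
      (kreinAdjoint T).domain = T.adjoint.domain.map parity) ∧
    -- separated boundary conditions
    (∀ T : L2 →ₗ.[ℂ] L2, T ≤ maxOp q → ∀ (ξ η : ℂ) (a b : ℝ), ‖ξ‖ = 1 → ‖η‖ = 1 →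
      (T.domain : Set L2) = normalizedSeparatedDomain q w₁ w₂ ξ η a b →
      (T.adjoint.domain : Set L2) = separatedDomain q w₁ w₂
        (Real.cos a) (-(ξ * Real.sin a)) (Real.cos b) (-(η * Real.sin b)) ∧
      ((kreinAdjoint T).domain : Set L2) = separatedDomain q w₁ w₂
        (Real.cos b) (η * Real.sin b) (Real.cos a) (ξ * Real.sin a)) ∧
    -- mixed boundary conditions expressing the values at `+∞` through those at `-∞`
    (∀ T : L2 →ₗ.[ℂ] L2, T ≤ maxOp q → ∀ a b c d : ℂ,
      (T.domain : Set L2) = betaOfAlphaDomain q w₁ w₂ !![a, b; c, d] →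
      (T.adjoint.domain : Set L2) =
        alphaOfBetaDomain q w₁ w₂ !![conj d, -conj b; -conj c, conj a] ∧
      ((kreinAdjoint T).domain : Set L2) =
        betaOfAlphaDomain q w₁ w₂ !![conj d, conj b; conj c, conj a]) ∧
    -- mixed boundary conditions expressing the values at `-∞` through those at `+∞`
    (∀ T : L2 →ₗ.[ℂ] L2, T ≤ maxOp q → ∀ a b c d : ℂ,
      (T.domain : Set L2) = alphaOfBetaDomain q w₁ w₂ !![a, b; c, d] →
      (T.adjoint.domain : Set L2) =
        betaOfAlphaDomain q w₁ w₂ !![conj d, -conj b; -conj c, conj a] ∧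
      ((kreinAdjoint T).domain : Set L2) =
        alphaOfBetaDomain q w₁ w₂ !![conj d, conj b; conj c, conj a]) := by
  lift w₁ to maxFun q using hw.sol₁.mem_maxFun hTop hBot
  lift w₂ to maxFun q using hw.sol₂.mem_maxFun hTop hBot
  have hw₀ := hw.isFundamentalPair
  refine ⟨fun T hT => ?_, fun T _ => kreinAdjoint_domain T, fun T hT ξ η a b hξ hη hdom => ?_,
    fun T hT a b c d hdom => ?_, fun T hT a b c d hdom => ?_⟩
  · rcases hT.domain_cases hw₀ with hsep | ⟨M, hM⟩ | ⟨M, hM⟩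
    · exact Or.inl hsep
    · exact Or.inr (Or.inl ⟨_, _, _, _, hM.trans (congrArg _ M.eta_fin_two)⟩)
    · exact Or.inr (Or.inr ⟨_, _, _, _, hM.trans (congrArg _ M.eta_fin_two)⟩)
  · have hadj := adjoint_domain_of_normalizedSeparatedDomain hw₀ hT hξ hη hdom
    exact ⟨hadj, kreinAdjoint_domain_of_separatedDomain hq_even hw hadj⟩
  · have hadj := adjoint_domain_of_betaOfAlphaDomain hw₀ hT hdom
    exact ⟨hadj, kreinAdjoint_domain_of_alphaOfBetaDomain hq_even hw hadj⟩
  · have hadj := adjoint_domain_of_alphaOfBetaDomain hw₀ hT hdom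
    exact ⟨hadj, kreinAdjoint_domain_of_betaOfAlphaDomain hq_even hw hadj⟩
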